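/- Let $I=[a,b]$ with $-\infty<a<b<\infty$, let $1<p,q<\infty$ and $1/p'=1-1/p$, and let $u,v$ be positive functions on $I$ with $u\in L_{p'}(I)$ and $v\in L_q(I)$. For $t\in\mathbb{R}$ and $s\in\{p,q\}$ write $t_{(s)}=|t|^{s-1}\operatorname{sgn}(t)$, and put $$(Tf)(x)=v(x)\int_a^x f(t)u(t)\,dt,\qquad (T^*h)(x)=u(x)\int_x^b v(y)h(y)\,dy,\qquad x\in I.$$ A spectral triple is a triple $(g,f,\lambda)$ with $f\in L_p(I)$, $\|f\|_p=1$, $\lambda\in\mathbb{R}$, such that $g=Tf$ and $f_{(p)}=\lambda\,T^*(g_{(q)})$ on $I$. For $n\in\{0,1,2,\dots\}$ let $SP_n(T,p,q)$ be the set of all spectral triples $(g,f,\lambda)$ for which $g$ has exactly $n$ distinct zeros in the open interval $(a,b)$. Then $SP_n(T,p,q)\neq\emptyset$ for every $n\in\{0,1,2,\dots\}$. -/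

import Mathlib

open MeasureTheory

noncomputable section

namespace HardySystem

/-- The signed power `(t)_(p) = |t|^(p-1) sgn t`. -/
def signedPow (p t : ℝ) : ℝ := |t| ^ (p - 1) * Real.sign t

/-- The Hardy-type operator `(T f)(x) = v(x) ∫_a^x f(t) u(t) dt`. -/
def hardyOp (a : ℝ) (u v f : ℝ → ℝ) (x : ℝ) : ℝ :=
  v x * ∫ t in a..x, f t * u t

/-- The operator `(T* h)(x) = u(x) ∫_x^b v(y) h(y) dy`. -/
def hardyDual (b : ℝ) (u v h : ℝ → ℝ) (x : ℝ) : ℝ :=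
  u x * ∫ y in x..b, v y * h y

/-- `SP(T,p,q)`: the spectral triples `(g, f, λ)`, that is, `f ∈ L_p(I)` with `‖f‖_p = 1`,
`g = T f` and `f_(p) = λ T*(g_(q))` on `I = [a,b]`. -/
def SP (a b p q : ℝ) (u v : ℝ → ℝ) : Set ((ℝ → ℝ) × (ℝ → ℝ) × ℝ) :=
  {τ | MemLp τ.2.1 (ENNReal.ofReal p) (volume.restrict (Set.Icc a b)) ∧
    eLpNorm τ.2.1 (ENNReal.ofReal p) (volume.restrict (Set.Icc a b)) = 1 ∧
    (∀ x ∈ Set.Icc a b, τ.1 x = hardyOp a u v τ.2.1 x) ∧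
    (∀ x ∈ Set.Icc a b,
      signedPow p (τ.2.1 x) = τ.2.2 * hardyDual b u v (fun y => signedPow q (τ.1 y)) x)}

/-- `Z(g)`: the number (possibly infinite) of distinct zeros of `g` in the open interval. -/
def zeroCount (a b : ℝ) (g : ℝ → ℝ) : ℕ∞ := {x ∈ Set.Ioo a b | g x = 0}.encard

/-- `SP_n(T,p,q)`: the spectral triples `(g, f, λ)` with `Z(g) = n`. -/
def SPn (a b p q : ℝ) (u v : ℝ → ℝ) (n : ℕ) : Set ((ℝ → ℝ) × (ℝ → ℝ) × ℝ) :=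
  {τ ∈ SP a b p q u v | zeroCount a b τ.1 = n}

end HardySystem

end

/-! Put `P = p'`, `U = u ^ P`, `V = v ^ q`. Up to constants, a spectral triple is a solution of the
planar system `F' = c₁ φ_P(G) U`, `G' = -c₂ φ_q(F) V` with `F(a) = 0`, `G(b) = 0`, where `φ_s` is
the signed power, `g` is proportional to `v F` and `f` to `φ_P(u G)`. The point `G + iF` only turns
counterclockwise, from the `G`-axis to the `F`-axis, so `g` has `n` interior zeros when the total
turn is `(2n+1)π/2`.

Such a solution is found by shooting on a discretisation. In a splitting scheme that moves `F` and
`G` alternately, the turning angle is continuous in the coefficient `c` of the `F`-kicks. It is `0`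
at `c = 0`. For large `c` the signs of `G` alternate from cell to cell (`kick_asymptotics`), so the
angle exceeds `(2n+1)π/2` as soon as there are more than `n` cells. The intermediate value theorem
gives the exact angle (`exists_angle_eq`, `exists_isWinding`).

To refine the grid one needs bounds independent of it. One of the `2n+1` quadrant passages is long,
and `F`, `G` are rescaled to modulus `1` in its middle. Monotonicity inside the quadrant then bounds
both coefficients, and a Gronwall-type chain through the quadrants bounds the sequence
(`exists_bounded_winding`). Arzelà–Ascoli and dominated convergence produce a limit solution with
switching points (`exists_isArcSolution`).

In the limit no quadrant may collapse. Nontriviality propagates from arc to arc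
(`arc_nondegenerate`), starting from the normalisation point, so the switching points are distinct
and the zeros of `F` are exactly those of even index (`zeroCount_fst`). -/

namespace HardySystem

/-! ### The signed power -/

theorem signedPow_of_nonneg {P t : ℝ} (hP : 1 < P) (ht : 0 ≤ t) :
    signedPow P t = t ^ (P - 1) := by
  rcases ht.eq_or_lt with rfl | h
  · simp [signedPow, Real.zero_rpow (by linarith : P - 1 ≠ 0)]
  · simp [signedPow, abs_of_pos h, Real.sign_of_pos h]

theorem signedPow_neg (P t : ℝ) : signedPow P (-t) = -signedPow P t := by
  simp [signedPow, Real.sign_neg]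

theorem signedPow_zero (P : ℝ) : signedPow P 0 = 0 := by simp [signedPow]

theorem signedPow_neg_one_pow (P : ℝ) (k : ℕ) : signedPow P ((-1) ^ k) = (-1) ^ k := by
  have h1 : signedPow P 1 = 1 := by simp [signedPow]
  rcases neg_one_pow_eq_or ℝ k with h | h <;> simp [h, signedPow_neg, h1]

theorem signedPow_pos {P t : ℝ} (ht : 0 < t) : 0 < signedPow P t := by
  rw [signedPow, Real.sign_of_pos ht, mul_one]
  exact Real.rpow_pos_of_pos (abs_pos.2 ht.ne') _

theorem signedPow_nonneg {P t : ℝ} (ht : 0 ≤ t) : 0 ≤ signedPow P t := by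
  rcases ht.eq_or_lt with rfl | h
  · rw [signedPow_zero]
  · exact (signedPow_pos h).le

theorem signedPow_mul (P s t : ℝ) : signedPow P (s * t) = signedPow P s * signedPow P t := by
  have h : Real.sign (s * t) = Real.sign s * Real.sign t := by
    rcases lt_trichotomy s 0 with hs | rfl | hs <;> rcases lt_trichotomy t 0 with ht | rfl | ht <;>
      simp [*, Real.sign_of_pos, Real.sign_of_neg, mul_pos_of_neg_of_neg, mul_neg_of_neg_of_pos,
        mul_neg_of_pos_of_neg]
  rw [signedPow, signedPow, signedPow, h, abs_mul, Real.mul_rpow (abs_nonneg _) (abs_nonneg _)]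
  ring

theorem mul_signedPow_pos {P t : ℝ} (ht : t ≠ 0) : 0 < signedPow P t * t := by
  rcases lt_or_gt_of_ne ht with h | h
  · have := signedPow_pos (P := P) (neg_pos.2 h)
    rw [signedPow_neg] at this
    nlinarith
  · exact mul_pos (signedPow_pos h) h

theorem mul_signedPow_nonneg (P t : ℝ) : 0 ≤ signedPow P t * t := by
  by_cases h : t = 0
  · simp [h]
  · exact (mul_signedPow_pos h).le

theorem signedPow_ne_zero {P t : ℝ} (ht : t ≠ 0) : signedPow P t ≠ 0 :=
  fun h => by simpa [h] using mul_signedPow_pos (P := P) ht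

theorem abs_signedPow {P : ℝ} (hP : 1 < P) (t : ℝ) : |signedPow P t| = |t| ^ (P - 1) := by
  rcases le_total 0 t with h | h
  · rw [signedPow_of_nonneg hP h, abs_of_nonneg h, abs_of_nonneg (Real.rpow_nonneg h _)]
  · have h' : 0 ≤ -t := by linarith
    rw [← neg_neg t, signedPow_neg, abs_neg, abs_neg, signedPow_of_nonneg hP h', abs_of_nonneg h',
      abs_of_nonneg (Real.rpow_nonneg h' _)]

theorem signedPow_abs {P : ℝ} (hP : 1 < P) (t : ℝ) : signedPow P |t| = |signedPow P t| := by
  rw [signedPow_of_nonneg hP (abs_nonneg t), abs_signedPow hP]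

theorem signedPow_le_signedPow {P s t : ℝ} (hP : 1 < P) (hs : 0 ≤ s) (h : s ≤ t) :
    signedPow P s ≤ signedPow P t := by
  rw [signedPow_of_nonneg hP hs, signedPow_of_nonneg hP (hs.trans h)]
  exact Real.rpow_le_rpow hs h (by linarith)

theorem continuous_signedPow {P : ℝ} (hP : 1 < P) : Continuous (signedPow P) := by
  have h : signedPow P = fun t => (max t 0) ^ (P - 1) - (max (-t) 0) ^ (P - 1) := by
    have h0 : (0 : ℝ) ^ (P - 1) = 0 := Real.zero_rpow (by linarith)
    funext t
    rcases le_total 0 t with h | h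
    · rw [signedPow_of_nonneg hP h, max_eq_left h, max_eq_right (by linarith), h0, sub_zero]
    · rw [max_eq_right h, max_eq_left (by linarith), h0, zero_sub,
        ← signedPow_of_nonneg hP (by linarith), signedPow_neg, neg_neg]
  rw [h]
  have hP' : 0 ≤ P - 1 := by linarith
  exact ((continuous_id.max continuous_const).rpow_const fun _ => Or.inr hP').sub
    ((continuous_id.neg.max continuous_const).rpow_const fun _ => Or.inr hP')

theorem signedPow_signedPow_conj {p q : ℝ} (h : p.HolderConjugate q) (t : ℝ) :
    signedPow p (signedPow q t) = t := by
  have key : ∀ t : ℝ, 0 ≤ t → signedPow p (signedPow q t) = t := fun t ht => by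
    rw [signedPow_of_nonneg h.symm.lt ht, signedPow_of_nonneg h.lt (Real.rpow_nonneg ht _),
      ← Real.rpow_mul ht, show (q - 1) * (p - 1) = 1 by linarith [h.mul_eq_add], Real.rpow_one]
  rcases le_total 0 t with ht | ht
  · exact key t ht
  · have := key (-t) (by linarith)
    rwa [signedPow_neg, signedPow_neg, neg_inj] at this

/-! ### A splitting scheme and its rotation angle -/

/-- One step of the splitting scheme for `dF = φ_P(G) dm`, `dG = -φ_Q(F) dl`. -/
structure IsKick (P Q : ℝ) (m l F G : ℕ → ℝ) : Prop where
  fst_succ : ∀ j, F (j + 1) = F j + m j * signedPow P (G j)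
  snd_succ : ∀ j, G (j + 1) = G j - l j * signedPow Q (F j)

/-- The solution of the splitting scheme issued from `(0, 1)`. -/
noncomputable def kick (P Q : ℝ) (m l : ℕ → ℝ) : ℕ → ℝ × ℝ
  | 0 => (0, 1)
  | j + 1 => ((kick P Q m l j).1 + m j * signedPow P (kick P Q m l j).2,
      (kick P Q m l j).2 - l j * signedPow Q (kick P Q m l j).1)

theorem isKick_kick (P Q : ℝ) (m l : ℕ → ℝ) :
    IsKick P Q m l (fun j => (kick P Q m l j).1) (fun j => (kick P Q m l j).2) :=
  ⟨fun _ => rfl, fun _ => rfl⟩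

/-- The total rotation angle of the planar sequence `(G, F)`. -/
noncomputable def angle (F G : ℕ → ℝ) (j : ℕ) : ℝ :=
  ∑ i ∈ Finset.range j, Complex.arg ((⟨G (i + 1), F (i + 1)⟩ : ℂ) / ⟨G i, F i⟩)

theorem angle_succ (F G : ℕ → ℝ) (j : ℕ) : angle F G (j + 1) =
    angle F G j + Complex.arg ((⟨G (j + 1), F (j + 1)⟩ : ℂ) / ⟨G j, F j⟩) :=
  Finset.sum_range_succ _ _

namespace IsKick

variable {P Q : ℝ} {m l F G : ℕ → ℝ}

/-- Since `m j * l j = 0`, a step alters one coordinate by a function of the other, so it is an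
invertible shear fixing the origin. -/
theorem mk_ne_zero (h : IsKick P Q m l F G) (hml : ∀ j, m j * l j = 0)
    (h0 : (⟨G 0, F 0⟩ : ℂ) ≠ 0) (j : ℕ) : (⟨G j, F j⟩ : ℂ) ≠ 0 := by
  induction j with
  | zero => exact h0
  | succ j ih =>
    intro hz
    apply ih
    rw [Complex.ext_iff] at hz ⊢
    simp only [Complex.zero_re, Complex.zero_im] at hz ⊢
    rw [h.fst_succ, h.snd_succ] at hz
    obtain ⟨h1, h2⟩ := hz
    rcases mul_eq_zero.1 (hml j) with hm | hl
    · rw [hm, zero_mul, add_zero] at h2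
      rw [h2, signedPow_zero, mul_zero, sub_zero] at h1
      exact ⟨h1, h2⟩
    · rw [hl, zero_mul, sub_zero] at h1
      rw [h1, signedPow_zero, mul_zero, add_zero] at h2
      exact ⟨h1, h2⟩

/-- The numerator of the imaginary part is `m φ_P(G) G + l φ_Q(F) F`, a sum of nonnegative terms
that vanishes only for a trivial step. Thus every step turns counterclockwise by an angle in `[0,
π)`. -/
theorem ratio_eq_one_or_im_pos (h : IsKick P Q m l F G) (hm : ∀ j, 0 ≤ m j) (hl : ∀ j, 0 ≤ l j)
    (j : ℕ) (hj : (⟨G j, F j⟩ : ℂ) ≠ 0) :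
    (⟨G (j + 1), F (j + 1)⟩ : ℂ) / ⟨G j, F j⟩ = 1 ∨
      0 < ((⟨G (j + 1), F (j + 1)⟩ : ℂ) / ⟨G j, F j⟩).im := by
  have hN : 0 < Complex.normSq ⟨G j, F j⟩ := Complex.normSq_pos.2 hj
  have him : ((⟨G (j + 1), F (j + 1)⟩ : ℂ) / ⟨G j, F j⟩).im =
      (m j * (signedPow P (G j) * G j) + l j * (signedPow Q (F j) * F j)) /
        Complex.normSq ⟨G j, F j⟩ := by
    rw [Complex.div_im]
    simp only [h.fst_succ, h.snd_succ]
    field_simp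
    ring
  have h1 := mul_nonneg (hm j) (mul_signedPow_nonneg P (G j))
  have h2 := mul_nonneg (hl j) (mul_signedPow_nonneg Q (F j))
  rcases (add_nonneg h1 h2).eq_or_lt with h0 | h0
  · left
    have e1 : m j * signedPow P (G j) = 0 := by
      by_cases hG : G j = 0
      · simp [hG, signedPow_zero]
      · have : m j * (signedPow P (G j) * G j) = 0 := by linarith
        rcases mul_eq_zero.1 this with h | h
        · simp [h]
        · exact absurd h (mul_signedPow_pos hG).ne'
    have e2 : l j * signedPow Q (F j) = 0 := by
      by_cases hF : F j = 0
      · simp [hF, signedPow_zero]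
      · have : l j * (signedPow Q (F j) * F j) = 0 := by linarith
        rcases mul_eq_zero.1 this with h | h
        · simp [h]
        · exact absurd h (mul_signedPow_pos hF).ne'
    rw [h.fst_succ, h.snd_succ, e1, e2, add_zero, sub_zero, div_self hj]
  · right
    rw [him]
    exact div_pos h0 hN

/-- `arg` is continuous on the slit plane; this is what makes the total angle continuous in the
parameter. -/
theorem ratio_mem_slitPlane (h : IsKick P Q m l F G) (hm : ∀ j, 0 ≤ m j) (hl : ∀ j, 0 ≤ l j)
    (j : ℕ) (hj : (⟨G j, F j⟩ : ℂ) ≠ 0) :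
    (⟨G (j + 1), F (j + 1)⟩ : ℂ) / ⟨G j, F j⟩ ∈ Complex.slitPlane := by
  rcases h.ratio_eq_one_or_im_pos hm hl j hj with h1 | h1
  · rw [h1]; exact Complex.one_mem_slitPlane
  · exact Or.inr h1.ne'

theorem angle_le_succ (h : IsKick P Q m l F G) (hm : ∀ j, 0 ≤ m j) (hl : ∀ j, 0 ≤ l j)
    (j : ℕ) (hj : (⟨G j, F j⟩ : ℂ) ≠ 0) : angle F G j ≤ angle F G (j + 1) := by
  rw [angle_succ]
  have : 0 ≤ Complex.arg ((⟨G (j + 1), F (j + 1)⟩ : ℂ) / ⟨G j, F j⟩) := by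
    rw [Complex.arg_nonneg_iff]
    rcases h.ratio_eq_one_or_im_pos hm hl j hj with h1 | h1
    · rw [h1]; simp
    · exact h1.le
  linarith

theorem angle_succ_lt (h : IsKick P Q m l F G) (hm : ∀ j, 0 ≤ m j) (hl : ∀ j, 0 ≤ l j)
    (j : ℕ) (hj : (⟨G j, F j⟩ : ℂ) ≠ 0) : angle F G (j + 1) < angle F G j + Real.pi := by
  rw [angle_succ]
  have := Complex.slitPlane_arg_ne_pi (h.ratio_mem_slitPlane hm hl j hj)
  have := lt_of_le_of_ne (Complex.arg_le_pi _) this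
  linarith

theorem exists_polar (h : IsKick P Q m l F G) (hml : ∀ j, m j * l j = 0)
    (hF : F 0 = 0) (hG : G 0 = 1) (j : ℕ) :
    ∃ ρ > 0, F j = ρ * Real.sin (angle F G j) ∧ G j = ρ * Real.cos (angle F G j) := by
  have h0 : (⟨G 0, F 0⟩ : ℂ) ≠ 0 := by simp [hF, hG, Complex.ext_iff]
  have hne := h.mk_ne_zero hml h0
  have key : (⟨G j, F j⟩ : ℂ) =
      (‖(⟨G j, F j⟩ : ℂ)‖ : ℂ) * Complex.exp (angle F G j * Complex.I) := by
    induction j with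
    | zero => simp [angle, hF, hG, show (⟨1, 0⟩ : ℂ) = 1 from rfl]
    | succ j ih =>
      set w := (⟨G (j + 1), F (j + 1)⟩ : ℂ) / ⟨G j, F j⟩ with hw
      have e : (⟨G (j + 1), F (j + 1)⟩ : ℂ) = w * ⟨G j, F j⟩ := by
        rw [hw, div_mul_cancel₀ _ (hne j)]
      rw [angle_succ, ← hw, e, norm_mul]
      conv_lhs => rw [ih, ← Complex.norm_mul_exp_arg_mul_I w]
      push_cast
      rw [add_mul, Complex.exp_add]
      ring
  refine ⟨‖(⟨G j, F j⟩ : ℂ)‖, norm_pos_iff.2 (hne j), ?_, ?_⟩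
  · have := congrArg Complex.im key
    rwa [Complex.im_ofReal_mul, Complex.exp_ofReal_mul_I_im] at this
  · have := congrArg Complex.re key
    rwa [Complex.re_ofReal_mul, Complex.exp_ofReal_mul_I_re] at this

end IsKick

/-- A kick leaves one coordinate fixed and turns by less than `π`. If it crossed a multiple of `π`,
the preserved coordinate `ρ sin` would change sign or vanish, which is impossible. -/
theorem lt_nat_mul_pi_of_sin {x y r s : ℝ} (hr : 0 < r) (hs : 0 < s) (hxy : y < x + Real.pi)
    (h : r * Real.sin x = s * Real.sin y) {k : ℕ} (hk : x < k * Real.pi) : y < k * Real.pi := by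
  by_contra! hy
  have h1 : 0 < Real.sin (k * Real.pi - x) :=
    Real.sin_pos_of_pos_of_lt_pi (by linarith) (by linarith)
  have h2 : 0 ≤ Real.sin (y - k * Real.pi) :=
    Real.sin_nonneg_of_nonneg_of_le_pi (by linarith) (by linarith)
  have e1 := Real.sin_nat_mul_pi_sub (k * Real.pi - x) k
  have e2 := Real.sin_add_nat_mul_pi (y - k * Real.pi) k
  rw [sub_sub_cancel] at e1
  rw [sub_add_cancel] at e2
  rw [e1, e2] at h
  have h3 := mul_pos hr h1
  have h4 := mul_nonneg hs.le h2
  rcases neg_one_pow_eq_or ℝ k with hk | hk <;> rw [hk] at h <;> linarith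

/-- The point `(x, y)` lies in the closed `k`-th quadrant, quadrants being counted along the
direction of rotation from `(0, 1)` to `(1, 0)`. -/
def InQuadrant (k : ℕ) (x y : ℝ) : Prop :=
  0 ≤ (-1) ^ (k / 2) * x ∧ 0 ≤ (-1) ^ ((k + 1) / 2) * y

theorem inQuadrant_sin_cos {ρ θ : ℝ} (hρ : 0 < ρ) {k : ℕ} (h1 : k * (Real.pi / 2) ≤ θ)
    (h2 : θ ≤ (k + 1) * (Real.pi / 2)) : InQuadrant k (ρ * Real.sin θ) (ρ * Real.cos θ) := by
  have hpi := Real.pi_pos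
  rcases Nat.even_or_odd' k with ⟨i, rfl | rfl⟩
  · push_cast at h1 h2
    have e1 := Real.sin_add_nat_mul_pi (θ - i * Real.pi) i
    have e2 := Real.cos_add_nat_mul_pi (θ - i * Real.pi) i
    rw [sub_add_cancel] at e1 e2
    have s1 : 0 ≤ Real.sin (θ - i * Real.pi) :=
      Real.sin_nonneg_of_nonneg_of_le_pi (by linarith) (by linarith)
    have s2 : 0 ≤ Real.cos (θ - i * Real.pi) :=
      Real.cos_nonneg_of_neg_pi_div_two_le_of_le (by linarith) (by linarith)
    rw [InQuadrant, show 2 * i / 2 = i by omega, show (2 * i + 1) / 2 = i by omega, e1, e2]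
    have s3 := mul_nonneg hρ.le s1
    have s4 := mul_nonneg hρ.le s2
    rcases neg_one_pow_eq_or ℝ i with hk | hk <;> rw [hk] <;> constructor <;> linarith
  · push_cast at h1 h2
    have e1 := Real.sin_add_nat_mul_pi (θ - i * Real.pi) i
    have e2 := Real.cos_add_nat_mul_pi (θ - i * Real.pi) i
    rw [sub_add_cancel] at e1 e2
    have s1 : 0 ≤ Real.sin (θ - i * Real.pi) :=
      Real.sin_nonneg_of_nonneg_of_le_pi (by linarith) (by linarith)
    have s2 : Real.cos (θ - i * Real.pi) ≤ 0 :=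
      Real.cos_nonpos_of_pi_div_two_le_of_le (by linarith) (by linarith)
    rw [InQuadrant, show (2 * i + 1) / 2 = i by omega, show (2 * i + 1 + 1) / 2 = i + 1 by omega,
      e1, e2, pow_succ]
    have s3 := mul_nonneg hρ.le s1
    have s4 := mul_nonpos_of_nonneg_of_nonpos hρ.le s2
    rcases neg_one_pow_eq_or ℝ i with hk | hk <;> rw [hk] <;> constructor <;> linarith

end HardySystem

/-! ### Large-coefficient asymptotics and shooting for the rotation angle. -/

namespace HardySystem

open Filter Topology

theorem signedPow_div_rpow {P c : ℝ} (hP : 1 < P) (hc : 0 < c) (x e : ℝ) :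
    signedPow P (x / c ^ e) = signedPow P x / c ^ ((P - 1) * e) := by
  have hce : 0 < c ^ e := Real.rpow_pos_of_pos hc e
  have h : signedPow P (c ^ e) = c ^ ((P - 1) * e) := by
    rw [signedPow_of_nonneg hP hce.le, ← Real.rpow_mul hc.le, mul_comm]
  rw [eq_div_iff (Real.rpow_pos_of_pos hc _).ne', ← h, ← signedPow_mul,
    div_mul_cancel₀ _ hce.ne']

/-- For large `c` each kick swamps the coordinate it modifies: if `G ~ γ c ^ e`, then the next `F`
is of order `c ^ (1 + (P-1)e)`, and the next `G` is of order `c ^ ((Q-1)(1 + (P-1)e))` with the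
opposite sign. The inequality on `e` says that the new term dominates the old `G`, and it reproduces
itself under this recursion. -/
theorem kick_asymptotics {P Q : ℝ} (hP : 1 < P) (hQ : 1 < Q) {m l : ℕ → ℝ}
    (hm : ∀ k, 0 < m (2 * k)) (hm' : ∀ k, m (2 * k + 1) = 0)
    (hl : ∀ k, 0 < l (2 * k + 1)) (hl' : ∀ k, l (2 * k) = 0) (k : ℕ) :
    ∃ e γ : ℝ, 0 < (-1) ^ k * γ ∧ e < (Q - 1) * (1 + (P - 1) * e) ∧
      Tendsto (fun c => (kick P Q (fun j => c * m j) l (2 * k)).2 / c ^ e) atTop (𝓝 γ) ∧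
      Tendsto (fun c => (kick P Q (fun j => c * m j) l (2 * k)).1 / c ^ (1 + (P - 1) * e))
        atTop (𝓝 0) := by
  induction k with
  | zero => exact ⟨0, 1, by simp, by linarith, by simp [kick], by simp [kick]⟩
  | succ k ih =>
    obtain ⟨e, γ, hγ, he, hG, hF⟩ := ih
    have hG1 : ∀ c, (kick P Q (fun j => c * m j) l (2 * k + 1)).2 =
        (kick P Q (fun j => c * m j) l (2 * k)).2 := fun c => by simp [kick, hl']
    have hF1 : ∀ c, (kick P Q (fun j => c * m j) l (2 * (k + 1))).1 =
        (kick P Q (fun j => c * m j) l (2 * k + 1)).1 := fun c => by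
      simp [Nat.mul_add, kick, hm']
    have hF2 : ∀ c, (kick P Q (fun j => c * m j) l (2 * k + 1)).1 =
        (kick P Q (fun j => c * m j) l (2 * k)).1 + c * m (2 * k) *
          signedPow P (kick P Q (fun j => c * m j) l (2 * k)).2 := fun c => rfl
    have hG2 : ∀ c, (kick P Q (fun j => c * m j) l (2 * (k + 1))).2 =
        (kick P Q (fun j => c * m j) l (2 * k)).2 - l (2 * k + 1) *
          signedPow Q (kick P Q (fun j => c * m j) l (2 * k + 1)).1 := fun c => by
      rw [← hG1]; rfl
    set d := 1 + (P - 1) * e with hd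
    have hFd : Tendsto (fun c => (kick P Q (fun j => c * m j) l (2 * k + 1)).1 / c ^ d) atTop
        (𝓝 (m (2 * k) * signedPow P γ)) := by
      have := hF.add ((((continuous_signedPow hP).tendsto γ).comp hG).const_mul (m (2 * k)))
      rw [zero_add] at this
      refine this.congr' ?_
      filter_upwards [eventually_gt_atTop 0] with c hc
      rw [Function.comp_apply, signedPow_div_rpow hP hc, hF2, add_div, hd, Real.rpow_add hc,
        Real.rpow_one]
      congr 1
      have := (Real.rpow_pos_of_pos hc ((P - 1) * e)).ne'
      field_simp
    have hpow : ∀ s : ℝ, s < 0 → Tendsto (fun c : ℝ => c ^ s) atTop (𝓝 0) := fun s hs => by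
      have := tendsto_rpow_neg_atTop (y := -s) (by linarith)
      simpa using this
    refine ⟨(Q - 1) * d, -(l (2 * k + 1) * signedPow Q (m (2 * k) * signedPow P γ)), ?_, ?_, ?_, ?_⟩
    · have h1 : 0 < (-1) ^ k * signedPow P γ := by
        have := signedPow_pos (P := P) hγ
        rwa [signedPow_mul, signedPow_neg_one_pow] at this
      have h2 : 0 < (-1) ^ k * signedPow Q (m (2 * k) * signedPow P γ) := by
        have : 0 < (-1) ^ k * (m (2 * k) * signedPow P γ) := by
          have := mul_pos (hm k) h1
          linarith
        have := signedPow_pos (P := Q) this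
        rwa [signedPow_mul, signedPow_neg_one_pow] at this
      have := mul_pos (hl k) h2
      rw [pow_succ]
      linarith
    · have h1 : (P - 1) * e < (P - 1) * ((Q - 1) * d) :=
        mul_lt_mul_of_pos_left he (by linarith)
      exact mul_lt_mul_of_pos_left (by linarith) (by linarith)
    · have := (hG.mul (hpow (e - (Q - 1) * d) (by linarith))).sub
        ((((continuous_signedPow hQ).tendsto _).comp hFd).const_mul (l (2 * k + 1)))
      rw [mul_zero, zero_sub] at this
      refine this.congr' ?_
      filter_upwards [eventually_gt_atTop 0] with c hc
      rw [Function.comp_apply, signedPow_div_rpow hQ hc, hG2, sub_div, Real.rpow_sub hc]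
      have := (Real.rpow_pos_of_pos hc e).ne'
      congr 1
      · field_simp
      · rw [mul_div_assoc]
    · have h1 : (P - 1) * e < (P - 1) * ((Q - 1) * d) :=
        mul_lt_mul_of_pos_left he (by linarith)
      have := hFd.mul (hpow (d - (1 + (P - 1) * ((Q - 1) * d))) (by linarith))
      rw [mul_zero] at this
      refine this.congr' ?_
      filter_upwards [eventually_gt_atTop 0] with c hc
      have := (Real.rpow_pos_of_pos hc d).ne'
      rw [hF1, Real.rpow_sub hc]
      field_simp

theorem continuous_kick {P Q : ℝ} (hP : 1 < P) (hQ : 1 < Q) (m l : ℕ → ℝ) (j : ℕ) :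
    Continuous fun c : ℝ => kick P Q (fun j => c * m j) l j := by
  induction j with
  | zero => exact continuous_const
  | succ j ih =>
    have hP' := continuous_signedPow hP
    have hQ' := continuous_signedPow hQ
    simp only [kick]
    fun_prop

/-- `G` has the sign of the cosine of the angle. The angle never decreases, and a sign `(-1)^(k+1)`
excludes the interval `[(2k-1)π/2, (2k+1)π/2]`, on which the cosine has sign `(-1)^k` or is zero. So
each sign change forces another half turn. -/
theorem lt_angle_of_alternating {P Q : ℝ} {m l F G : ℕ → ℝ}
    (h : IsKick P Q m l F G) (hm : ∀ j, 0 ≤ m j) (hl : ∀ j, 0 ≤ l j) (hml : ∀ j, m j * l j = 0)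
    (hF : F 0 = 0) (hG : G 0 = 1) (k : ℕ) (hs : ∀ i ≤ k + 1, 0 < (-1) ^ i * G (2 * i)) :
    (2 * k + 1) * (Real.pi / 2) < angle F G (2 * (k + 1)) := by
  have h0 : (⟨G 0, F 0⟩ : ℂ) ≠ 0 := by simp [hF, hG, Complex.ext_iff]
  have hmono : Monotone (angle F G) :=
    monotone_nat_of_le_succ fun j => h.angle_le_succ hm hl j (h.mk_ne_zero hml h0 j)
  have hpi := Real.pi_pos
  have key : ∀ k : ℕ, 0 < (-1) ^ (k + 1) * G (2 * (k + 1)) →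
      (2 * k - 1) * (Real.pi / 2) ≤ angle F G (2 * (k + 1)) →
      (2 * k + 1) * (Real.pi / 2) < angle F G (2 * (k + 1)) := fun k hk hk' => by
    by_contra! hlt
    obtain ⟨ρ, hρ, -, hc⟩ := h.exists_polar hml hF hG (2 * (k + 1))
    have e := Real.cos_add_nat_mul_pi (angle F G (2 * (k + 1)) - k * Real.pi) k
    rw [sub_add_cancel] at e
    have : 0 ≤ Real.cos (angle F G (2 * (k + 1)) - k * Real.pi) :=
      Real.cos_nonneg_of_neg_pi_div_two_le_of_le (by linarith) (by linarith)
    have := mul_nonneg hρ.le this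
    rw [hc, e, pow_succ] at hk
    rcases neg_one_pow_eq_or ℝ k with h | h <;> rw [h] at hk <;> linarith
  induction k with
  | zero =>
    refine key 0 (hs 1 le_rfl) ?_
    have : 0 ≤ angle F G (2 * (0 + 1)) := by
      have := hmono (Nat.zero_le (2 * (0 + 1)))
      simpa [angle] using this
    push_cast
    linarith
  | succ k ih =>
    refine key (k + 1) (hs _ le_rfl) ?_
    have h1 := ih fun i hi => hs i (by omega)
    have h2 := hmono (show 2 * (k + 1) ≤ 2 * (k + 1 + 1) by omega)
    push_cast
    linarith

/-- A planar sequence of length `L` that starts on the positive second axis and runs through the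
quadrants `0, 1, …, 2n` in order, `κ` being the quadrant index, to end on the second axis. -/
structure IsWinding (n L : ℕ) (κ : ℕ → ℕ) (F G : ℕ → ℝ) : Prop where
  fst_zero : F 0 = 0
  snd_last : G L = 0
  ne_zero : ∀ j, F j ≠ 0 ∨ G j ≠ 0
  mono : Monotone κ
  start : κ 0 = 0
  step : ∀ j, κ (j + 1) ≤ κ j + 1
  lt : ∀ j < L, κ j < 2 * n + 1
  last : κ L = 2 * n + 1
  mem : ∀ j, InQuadrant (κ j) (F j) (G j)

/-- Intermediate value theorem in `c`: at `c = 0` the point never leaves `(0, 1)`, and for large `c`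
the alternation over `N > n` cells makes the angle too big. -/
theorem exists_angle_eq {P Q : ℝ} (hP : 1 < P) (hQ : 1 < Q) {m l : ℕ → ℝ}
    (hm : ∀ k, 0 < m (2 * k)) (hm' : ∀ k, m (2 * k + 1) = 0)
    (hl : ∀ k, 0 < l (2 * k + 1)) (hl' : ∀ k, l (2 * k) = 0) (n N : ℕ) (hN : n < N) :
    ∃ c > 0, ∃ F G : ℕ → ℝ, IsKick P Q (fun j => c * m j) l F G ∧ F 0 = 0 ∧ G 0 = 1 ∧
      angle F G (2 * N) = (2 * n + 1) * (Real.pi / 2) := by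
  have hm0 : ∀ j, 0 ≤ m j := fun j => by
    rcases Nat.even_or_odd' j with ⟨i, rfl | rfl⟩
    exacts [(hm i).le, (hm' i).ge]
  have hl0 : ∀ j, 0 ≤ l j := fun j => by
    rcases Nat.even_or_odd' j with ⟨i, rfl | rfl⟩
    exacts [(hl' i).ge, (hl i).le]
  have hml : ∀ j, m j * l j = 0 := fun j => by
    rcases Nat.even_or_odd' j with ⟨i, rfl | rfl⟩
    · simp [hl']
    · simp [hm']
  set K := fun c : ℝ => kick P Q (fun j => c * m j) l with hK
  have hcml : ∀ c j, c * m j * l j = 0 := fun c j => by rw [mul_assoc, hml, mul_zero]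
  have hcm : ∀ c, 0 ≤ c → ∀ j, 0 ≤ c * m j := fun c hc j => mul_nonneg hc (hm0 j)
  have hkick : ∀ c, IsKick P Q (fun j => c * m j) l (fun j => (K c j).1) (fun j => (K c j).2) :=
    fun c => isKick_kick _ _ _ _
  have hne : ∀ c j, (⟨(K c j).2, (K c j).1⟩ : ℂ) ≠ 0 := fun c =>
    (hkick c).mk_ne_zero (hcml c) (by simp [hK, kick, Complex.ext_iff])
  set θ := fun c => angle (fun j => (K c j).1) (fun j => (K c j).2) (2 * N) with hθ
  have hcont : ContinuousOn θ (Set.Ici 0) := by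
    refine continuousOn_finsetSum _ fun j _ c hc => ?_
    refine ContinuousAt.comp_continuousWithinAt (g := Complex.arg) (Complex.continuousAt_arg
      ((hkick c).ratio_mem_slitPlane (hcm c hc) hl0 j (hne c j))) ?_
    have hz : ∀ j, Continuous fun c => (⟨(K c j).2, (K c j).1⟩ : ℂ) := fun j => by
      have := continuous_kick hP hQ m l j
      have h2 : (fun c => (⟨(K c j).2, (K c j).1⟩ : ℂ)) =
          fun c => Complex.equivRealProdCLM.symm ((K c j).2, (K c j).1) := by
        funext c; apply Complex.ext <;> simp
      rw [h2]
      exact Complex.equivRealProdCLM.symm.continuous.comp (this.snd.prodMk this.fst)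
    exact ((hz (j + 1)).continuousAt.div (hz j).continuousAt (hne c j)).continuousWithinAt
  have hzero : θ 0 = 0 := by
    have h0 : ∀ j, K 0 j = (0, 1) := fun j => by
      induction j with
      | zero => rfl
      | succ j ih =>
        have e : K 0 (j + 1) = ((K 0 j).1 + 0 * m j * signedPow P (K 0 j).2,
          (K 0 j).2 - l j * signedPow Q (K 0 j).1) := rfl
        simp [e, ih, signedPow_zero]
    simp [hθ, angle, h0, show (⟨1, 0⟩ : ℂ) = 1 from rfl]
  have hpi := Real.pi_pos
  obtain ⟨C, hC, hθC⟩ : ∃ C, 0 < C ∧ (2 * n + 1) * (Real.pi / 2) < θ C := by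
    obtain ⟨k, rfl⟩ : ∃ k, N = k + 1 := ⟨N - 1, by omega⟩
    have hev : ∀ᶠ c in atTop, ∀ i ∈ Finset.range (k + 2), 0 < (-1) ^ i * (K c (2 * i)).2 := by
      rw [eventually_all_finset]
      intro i _
      obtain ⟨e, γ, hγ, -, hG, -⟩ := kick_asymptotics hP hQ hm hm' hl hl' i
      filter_upwards [(hG.const_mul ((-1) ^ i)).eventually_const_lt hγ, eventually_gt_atTop 0]
        with c hc hc0
      rw [← mul_div_assoc] at hc
      exact (div_pos_iff_of_pos_right (Real.rpow_pos_of_pos hc0 e)).1 hc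
    obtain ⟨C, hs, hC⟩ := (hev.and (eventually_gt_atTop 0)).exists
    refine ⟨C, hC, lt_of_le_of_lt ?_ (lt_angle_of_alternating (hkick C) (hcm C hC.le) hl0 (hcml C)
      rfl rfl k fun i hi => hs i (Finset.mem_range.2 (by omega)))⟩
    have : (n : ℝ) ≤ k := by exact_mod_cast (by omega : n ≤ k)
    nlinarith
  have hy : (2 * n + 1) * (Real.pi / 2) ∈ Set.Icc (θ 0) (θ C) := ⟨by rw [hzero]; positivity, hθC.le⟩
  obtain ⟨c, hc, hce⟩ := intermediate_value_Icc hC.le (hcont.mono Set.Icc_subset_Ici_self) hy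
  refine ⟨c, lt_of_le_of_ne hc.1 ?_, _, _, hkick c, rfl, rfl, hce⟩
  rintro rfl
  rw [hzero] at hce
  have : 0 < (2 * n + 1) * (Real.pi / 2) := by positivity
  linarith

theorem exists_isWinding {P Q : ℝ} (hP : 1 < P) (hQ : 1 < Q) {m l : ℕ → ℝ}
    (hm : ∀ k, 0 < m (2 * k)) (hm' : ∀ k, m (2 * k + 1) = 0)
    (hl : ∀ k, 0 < l (2 * k + 1)) (hl' : ∀ k, l (2 * k) = 0) (n N : ℕ) (hN : n < N) :
    ∃ c > 0, ∃ (F G : ℕ → ℝ) (κ : ℕ → ℕ), IsKick P Q (fun j => c * m j) l F G ∧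
      IsWinding n (2 * N) κ F G := by
  obtain ⟨c, hc, F, G, h, hF0, hG0, hθ⟩ := exists_angle_eq hP hQ hm hm' hl hl' n N hN
  have hm0 : ∀ j, 0 ≤ c * m j := fun j => by
    rcases Nat.even_or_odd' j with ⟨i, rfl | rfl⟩
    · exact (mul_pos hc (hm i)).le
    · simp [hm']
  have hl0 : ∀ j, 0 ≤ l j := fun j => by
    rcases Nat.even_or_odd' j with ⟨i, rfl | rfl⟩
    exacts [(hl' i).ge, (hl i).le]
  have hml : ∀ j, c * m j * l j = 0 := fun j => by
    rcases Nat.even_or_odd' j with ⟨i, rfl | rfl⟩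
    · simp [hl']
    · simp [hm']
  have hne := h.mk_ne_zero hml (by simp [hF0, hG0, Complex.ext_iff])
  have hne' : ∀ j, F j ≠ 0 ∨ G j ≠ 0 := fun j => by
    by_contra! hj
    exact hne j (Complex.ext hj.2 hj.1)
  have hpol := h.exists_polar hml hF0 hG0
  have hmono : Monotone (angle F G) :=
    monotone_nat_of_le_succ fun j => h.angle_le_succ hm0 hl0 j (hne j)
  have hang0 : angle F G 0 = 0 := by simp [angle]
  have hnn : ∀ j, 0 ≤ angle F G j := fun j => by
    have := hmono (Nat.zero_le j)
    rwa [hang0] at this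
  have hpi := Real.pi_pos
  have hpi2 : 0 < Real.pi / 2 := by positivity
  -- The quadrant index is the number of completed quarter turns.
  set κ : ℕ → ℕ := fun j => ⌊angle F G j / (Real.pi / 2)⌋₊ with hκ
  have hκ1 : ∀ j, κ j * (Real.pi / 2) ≤ angle F G j := fun j => by
    have := Nat.floor_le (div_nonneg (hnn j) hpi2.le)
    rwa [le_div_iff₀ hpi2] at this
  have hκ2 : ∀ j, angle F G j < (κ j + 1) * (Real.pi / 2) := fun j => by
    have := Nat.lt_floor_add_one (angle F G j / (Real.pi / 2))
    rwa [div_lt_iff₀ hpi2] at this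
  have hκlt : ∀ j (k : ℕ), angle F G j < k * (Real.pi / 2) → κ j < k := fun j k hk => by
    have := (hκ1 j).trans_lt hk
    exact_mod_cast lt_of_mul_lt_mul_right this hpi2.le
  have hκm : Monotone κ := fun i j hij => Nat.floor_le_floor (by gcongr; exact hmono hij)
  have hlast : κ (2 * N) = 2 * n + 1 := by
    simp only [hκ]
    rw [hθ, mul_div_assoc, div_self hpi2.ne', mul_one]
    exact_mod_cast Nat.floor_natCast (2 * n + 1)
  have hmem : ∀ j, InQuadrant (κ j) (F j) (G j) := fun j => by
    obtain ⟨ρ, hρ, e1, e2⟩ := hpol j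
    rw [e1, e2]
    exact inQuadrant_sin_cos hρ (hκ1 j) (hκ2 j).le
  have hGlast : G (2 * N) = 0 := by
    obtain ⟨ρ, -, -, e2⟩ := hpol (2 * N)
    rw [e2, hθ, show (2 * (n : ℝ) + 1) * (Real.pi / 2) = Real.pi / 2 + n * Real.pi by ring,
      Real.cos_add_nat_mul_pi, Real.cos_pi_div_two, mul_zero, mul_zero]
  refine ⟨c, hc, F, G, κ, h, hF0, hGlast, hne', hκm, by simp [hκ, hang0], fun j => ?_,
    fun j hj => ?_, hlast, hmem⟩
  -- No kick skips a quadrant: if `F` is fixed, the angle cannot cross a multiple of `π`; if `G` is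
  -- fixed, it cannot cross an odd multiple of `π / 2`. The latter follows from the former after a
  -- shift by `π / 2`.
  · have hjump := h.angle_succ_lt hm0 hl0 j (hne j)
    obtain ⟨ρ, hρ, e1, e2⟩ := hpol j
    obtain ⟨ρ', hρ', e1', e2'⟩ := hpol (j + 1)
    have hlt := hκ2 j
    obtain ⟨i, hi | hi⟩ := Nat.even_or_odd' (κ j)
    all_goals
      have hi' : (κ j : ℝ) = _ := congrArg Nat.cast hi
      push_cast at hi'
      rw [hi'] at hlt
      rw [hi]
      rcases mul_eq_zero.1 (hml j) with h0 | h0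
    · have hFF : F (j + 1) = F j := by rw [h.fst_succ, h0]; simp
      have := lt_nat_mul_pi_of_sin hρ hρ' hjump (by rw [← e1, ← e1', hFF]) (k := i + 1)
        (by push_cast; linarith)
      have := hκlt (j + 1) (2 * i + 2) (by push_cast at this ⊢; linarith)
      omega
    · have hGG : G (j + 1) = G j := by rw [h.snd_succ, h0]; simp
      have := lt_nat_mul_pi_of_sin (x := angle F G j + Real.pi / 2)
        (y := angle F G (j + 1) + Real.pi / 2) hρ hρ' (by linarith)
        (by rw [Real.sin_add_pi_div_two, Real.sin_add_pi_div_two, ← e2, ← e2', hGG]) (k := i + 1)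
        (by push_cast; linarith)
      have := hκlt (j + 1) (2 * i + 1) (by push_cast at this ⊢; linarith)
      omega
    · have hFF : F (j + 1) = F j := by rw [h.fst_succ, h0]; simp
      have := lt_nat_mul_pi_of_sin hρ hρ' hjump (by rw [← e1, ← e1', hFF]) (k := i + 1)
        (by push_cast; linarith)
      have := hκlt (j + 1) (2 * i + 2) (by push_cast at this ⊢; linarith)
      omega
    · have hGG : G (j + 1) = G j := by rw [h.snd_succ, h0]; simp
      have := lt_nat_mul_pi_of_sin (x := angle F G j + Real.pi / 2)
        (y := angle F G (j + 1) + Real.pi / 2) hρ hρ' (by linarith)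
        (by rw [Real.sin_add_pi_div_two, Real.sin_add_pi_div_two, ← e2, ← e2', hGG]) (k := i + 2)
        (by push_cast; linarith)
      have := hκlt (j + 1) (2 * i + 3) (by push_cast at this ⊢; linarith)
      omega
  -- The last kick moves `G` and ends at `G = 0`. Had quadrant `2n+1` been reached before, this kick
  -- would push `G` further from zero, unless both coordinates were already zero.
  · by_contra! hge
    obtain ⟨i, rfl⟩ : ∃ i, N = i + 1 := ⟨N - 1, by omega⟩
    have hk : κ (2 * i + 1) = 2 * n + 1 := by
      have h1 := hκm (show j ≤ 2 * i + 1 by omega)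
      have h2 := hκm (show 2 * i + 1 ≤ 2 * (i + 1) by omega)
      omega
    obtain ⟨q1, q2⟩ := hmem (2 * i + 1)
    rw [hk, show (2 * n + 1) / 2 = n by omega] at q1
    rw [hk, show (2 * n + 1 + 1) / 2 = n + 1 by omega, pow_succ] at q2
    have hG := h.snd_succ (2 * i + 1)
    rw [show 2 * i + 1 + 1 = 2 * (i + 1) by ring, hGlast] at hG
    have hF : F (2 * i + 1) = 0 := by
      by_contra hF
      have h3 : 0 < (-1) ^ n * F (2 * i + 1) := lt_of_le_of_ne q1 (by
        symm; exact mul_ne_zero (pow_ne_zero _ (by norm_num)) hF)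
      have h4 := signedPow_pos (P := Q) h3
      rw [signedPow_mul, signedPow_neg_one_pow] at h4
      have h5 := mul_pos (hl i) h4
      have h6 : G (2 * i + 1) = l (2 * i + 1) * signedPow Q (F (2 * i + 1)) := by linarith
      rw [h6] at q2
      linarith
    rw [hF, signedPow_zero, mul_zero, sub_zero] at hG
    rcases hne' (2 * i + 1) with h7 | h7
    · exact h7 hF
    · exact h7 hG.symm

end HardySystem

namespace HardySystem

open Filter Topology

/-! ### A priori bounds for winding sequences -/

namespace IsKick

variable {P Q : ℝ} {m l F G : ℕ → ℝ}

/-- A quarter turn exchanges the two equations, so odd quadrants reduce to even ones. -/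
theorem rotate (h : IsKick P Q m l F G) : IsKick Q P l m (fun j => -G j) F :=
  ⟨fun j => by rw [h.snd_succ]; ring, fun j => by rw [h.fst_succ, signedPow_neg]; ring⟩

theorem sign_mul (h : IsKick P Q m l F G) (k : ℕ) :
    IsKick P Q m l (fun j => (-1) ^ k * F j) (fun j => (-1) ^ k * G j) :=
  ⟨fun j => by rw [h.fst_succ, signedPow_mul, signedPow_neg_one_pow]; ring,
    fun j => by rw [h.snd_succ, signedPow_mul, signedPow_neg_one_pow]; ring⟩

/-- `F` and `G` may be scaled independently at the price of changing both coefficients. This is why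
two constants `c₁`, `c₂` appear from here on. -/
theorem rescale {c : ℝ} (h : IsKick P Q (fun j => c * m j) l F G) {A B : ℝ} (hA : A ≠ 0)
    (hB : B ≠ 0) : IsKick P Q (fun j => c * signedPow P B / A * m j)
      (fun j => signedPow Q A / B * l j) (fun j => F j / A) (fun j => G j / B) := by
  have e1 : ∀ j, signedPow P (G j) = signedPow P B * signedPow P (G j / B) := fun j => by
    rw [← signedPow_mul, mul_div_cancel₀ _ hB]
  have e2 : ∀ j, signedPow Q (F j) = signedPow Q A * signedPow Q (F j / A) := fun j => by
    rw [← signedPow_mul, mul_div_cancel₀ _ hA]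
  refine ⟨fun j => ?_, fun j => ?_⟩
  · rw [h.fst_succ, e1]; ring
  · rw [h.snd_succ, e2]; ring

/-- In this quadrant `F` increases and `G` decreases, so every increment lies between its values at
the two ends of the range. -/
theorem bounds_of_nonneg (h : IsKick P Q m l F G) (hP : 1 < P) (hQ : 1 < Q)
    (hm : ∀ j, 0 ≤ m j) (hl : ∀ j, 0 ≤ l j) {i j : ℕ} (hij : i ≤ j)
    (hnn : ∀ x, i ≤ x → x ≤ j → 0 ≤ F x ∧ 0 ≤ G x) :
    F i + (∑ x ∈ Finset.Ico i j, m x) * signedPow P (G j) ≤ F j ∧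
    F j ≤ F i + (∑ x ∈ Finset.Ico i j, m x) * signedPow P (G i) ∧
    G j + (∑ x ∈ Finset.Ico i j, l x) * signedPow Q (F i) ≤ G i ∧
    G i ≤ G j + (∑ x ∈ Finset.Ico i j, l x) * signedPow Q (F j) := by
  induction j, hij using Nat.le_induction with
  | base => simp
  | succ j hij ih =>
    obtain ⟨i1, i2, i3, i4⟩ := ih fun x h1 h2 => hnn x h1 (by omega)
    obtain ⟨hFi, hGi⟩ := hnn i le_rfl (by omega)
    obtain ⟨hFj, hGj⟩ := hnn j hij (by omega)
    obtain ⟨hFj', hGj'⟩ := hnn (j + 1) (by omega) le_rfl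
    have hSm : 0 ≤ ∑ x ∈ Finset.Ico i j, m x := Finset.sum_nonneg fun x _ => hm x
    have hSl : 0 ≤ ∑ x ∈ Finset.Ico i j, l x := Finset.sum_nonneg fun x _ => hl x
    rw [Finset.sum_Ico_succ_top hij, Finset.sum_Ico_succ_top hij, add_mul, add_mul, add_mul,
      add_mul]
    have hF := h.fst_succ j
    have hG := h.snd_succ j
    have f1 : F i ≤ F j := by
      have := mul_nonneg hSm (signedPow_nonneg (P := P) hGj); linarith
    have g1 : G j ≤ G i := by
      have := mul_nonneg hSl (signedPow_nonneg (P := Q) hFi); linarith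
    have f2 : F j ≤ F (j + 1) := by
      have := mul_nonneg (hm j) (signedPow_nonneg (P := P) hGj); linarith
    have g2 : G (j + 1) ≤ G j := by
      have := mul_nonneg (hl j) (signedPow_nonneg (P := Q) hFj); linarith
    have a1 := mul_le_mul_of_nonneg_left (signedPow_le_signedPow hP hGj' g2) hSm
    have a2 := mul_le_mul_of_nonneg_left (signedPow_le_signedPow hP hGj' g2) (hm j)
    have a3 := mul_le_mul_of_nonneg_left (signedPow_le_signedPow hP hGj g1) (hm j)
    have b1 := mul_le_mul_of_nonneg_left (signedPow_le_signedPow hQ hFj f2) hSl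
    have b2 := mul_le_mul_of_nonneg_left (signedPow_le_signedPow hQ hFj f2) (hl j)
    have b3 := mul_le_mul_of_nonneg_left (signedPow_le_signedPow hQ hFi f1) (hl j)
    refine ⟨?_, ?_, ?_, ?_⟩ <;> linarith

theorem bounds_of_even (h : IsKick P Q m l F G) (hP : 1 < P) (hQ : 1 < Q)
    (hm : ∀ j, 0 ≤ m j) (hl : ∀ j, 0 ≤ l j) {i j k : ℕ} (hij : i ≤ j)
    (hquad : ∀ x, i ≤ x → x ≤ j → InQuadrant (2 * k) (F x) (G x)) :
    |F i| + (∑ x ∈ Finset.Ico i j, m x) * signedPow P |G j| ≤ |F j| ∧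
    |F j| ≤ |F i| + (∑ x ∈ Finset.Ico i j, m x) * signedPow P |G i| ∧
    |G j| + (∑ x ∈ Finset.Ico i j, l x) * signedPow Q |F i| ≤ |G i| ∧
    |G i| ≤ |G j| + (∑ x ∈ Finset.Ico i j, l x) * signedPow Q |F j| := by
  have hq : ∀ x, i ≤ x → x ≤ j → 0 ≤ (-1) ^ k * F x ∧ 0 ≤ (-1) ^ k * G x := fun x h1 h2 => by
    have := hquad x h1 h2
    rwa [InQuadrant, show 2 * k / 2 = k by omega, show (2 * k + 1) / 2 = k by omega] at this
  have habs : ∀ y : ℝ, 0 ≤ (-1) ^ k * y → (-1) ^ k * y = |y| := fun y hy => by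
    rw [← abs_of_nonneg hy, abs_mul, abs_pow]; simp
  have := (h.sign_mul k).bounds_of_nonneg hP hQ hm hl hij hq
  rwa [habs _ (hq i le_rfl hij).1, habs _ (hq i le_rfl hij).2, habs _ (hq j hij le_rfl).1,
    habs _ (hq j hij le_rfl).2] at this

theorem bounds_of_odd (h : IsKick P Q m l F G) (hP : 1 < P) (hQ : 1 < Q)
    (hm : ∀ j, 0 ≤ m j) (hl : ∀ j, 0 ≤ l j) {i j k : ℕ} (hij : i ≤ j)
    (hquad : ∀ x, i ≤ x → x ≤ j → InQuadrant (2 * k + 1) (F x) (G x)) :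
    |G i| + (∑ x ∈ Finset.Ico i j, l x) * signedPow Q |F j| ≤ |G j| ∧
    |G j| ≤ |G i| + (∑ x ∈ Finset.Ico i j, l x) * signedPow Q |F i| ∧
    |F j| + (∑ x ∈ Finset.Ico i j, m x) * signedPow P |G i| ≤ |F i| ∧
    |F i| ≤ |F j| + (∑ x ∈ Finset.Ico i j, m x) * signedPow P |G j| := by
  have := h.rotate.bounds_of_even hQ hP hl hm hij (k := k) fun x h1 h2 => by
    have := hquad x h1 h2
    rw [InQuadrant, show (2 * k + 1) / 2 = k by omega, show (2 * k + 1 + 1) / 2 = k + 1 by omega,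
      pow_succ] at this
    rw [InQuadrant, show 2 * k / 2 = k by omega, show (2 * k + 1) / 2 = k by omega]
    exact ⟨by linarith [this.2], this.1⟩
  simpa only [abs_neg] using this

/-- One of `|F|`, `|G|` grows along the quadrant and the other shrinks. The growing one is bounded
below at `M` by what it gained on the left part, the shrinking one by what it has yet to lose on the
right part. The parity of `k` decides which is which, and the minimum covers both cases. -/
theorem mid_bounds (h : IsKick P Q m l F G) (hP : 1 < P) (hQ : 1 < Q)
    (hm : ∀ j, 0 ≤ m j) (hl : ∀ j, 0 ≤ l j) {i j M k : ℕ} (hiM : i ≤ M) (hMj : M ≤ j)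
    (hquad : ∀ x, i ≤ x → x ≤ j → InQuadrant k (F x) (G x)) :
    min (∑ x ∈ Finset.Ico i M, m x) (∑ x ∈ Finset.Ico M j, m x) * signedPow P |G M| ≤ |F M| ∧
    min (∑ x ∈ Finset.Ico i M, l x) (∑ x ∈ Finset.Ico M j, l x) * signedPow Q |F M| ≤ |G M| := by
  have hG := signedPow_nonneg (P := P) (abs_nonneg (G M))
  have hF := signedPow_nonneg (P := Q) (abs_nonneg (F M))
  have hFi := abs_nonneg (F i)
  have hFj := abs_nonneg (F j)
  have hGi := abs_nonneg (G i)
  have hGj := abs_nonneg (G j)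
  have m1 := mul_le_mul_of_nonneg_right
    (min_le_left (∑ x ∈ Finset.Ico i M, m x) (∑ x ∈ Finset.Ico M j, m x)) hG
  have m2 := mul_le_mul_of_nonneg_right
    (min_le_right (∑ x ∈ Finset.Ico i M, m x) (∑ x ∈ Finset.Ico M j, m x)) hG
  have l1 := mul_le_mul_of_nonneg_right
    (min_le_left (∑ x ∈ Finset.Ico i M, l x) (∑ x ∈ Finset.Ico M j, l x)) hF
  have l2 := mul_le_mul_of_nonneg_right
    (min_le_right (∑ x ∈ Finset.Ico i M, l x) (∑ x ∈ Finset.Ico M j, l x)) hF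
  rcases Nat.even_or_odd' k with ⟨k, rfl | rfl⟩
  · have b1 := h.bounds_of_even hP hQ hm hl hiM fun x h1 h2 => hquad x h1 (by omega)
    have b2 := h.bounds_of_even hP hQ hm hl hMj fun x h1 h2 => hquad x (by omega) h2
    exact ⟨by linarith [b1.1], by linarith [b2.2.2.1]⟩
  · have b1 := h.bounds_of_odd hP hQ hm hl hiM fun x h1 h2 => hquad x h1 (by omega)
    have b2 := h.bounds_of_odd hP hQ hm hl hMj fun x h1 h2 => hquad x (by omega) h2
    exact ⟨by linarith [b2.2.2.1], by linarith [b1.1]⟩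

end IsKick

/-- The growth function that controls the scheme within a quadrant. -/
noncomputable def growth (P Q A K : ℝ) : ℝ := K + A * signedPow P K + A * signedPow Q K

section growth

variable {P Q A : ℝ}

theorem le_growth (hA : 0 ≤ A) {K : ℝ} (hK : 0 ≤ K) : K ≤ growth P Q A K := by
  have h1 := mul_nonneg hA (signedPow_nonneg (P := P) hK)
  have h2 := mul_nonneg hA (signedPow_nonneg (P := Q) hK)
  rw [growth]; linarith

theorem growth_le_growth (hP : 1 < P) (hQ : 1 < Q) (hA : 0 ≤ A) {K K' : ℝ} (hK : 0 ≤ K)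
    (h : K ≤ K') : growth P Q A K ≤ growth P Q A K' := by
  have h1 := mul_le_mul_of_nonneg_left (signedPow_le_signedPow hP hK h) hA
  have h2 := mul_le_mul_of_nonneg_left (signedPow_le_signedPow hQ hK h) hA
  rw [growth, growth]; linarith

theorem growth_iterate_nonneg (hA : 0 ≤ A) (e : ℕ) {K : ℝ} (hK : 0 ≤ K) :
    0 ≤ (growth P Q A)^[e] K := by
  induction e with
  | zero => exact hK
  | succ e ih => rw [Function.iterate_succ_apply']; exact ih.trans (le_growth hA ih)

theorem growth_iterate_le (hP : 1 < P) (hQ : 1 < Q) (hA : 0 ≤ A) (e : ℕ) {K K' : ℝ}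
    (hK : 0 ≤ K) (h : K ≤ K') : (growth P Q A)^[e] K ≤ (growth P Q A)^[e] K' := by
  induction e with
  | zero => exact h
  | succ e ih =>
    rw [Function.iterate_succ_apply', Function.iterate_succ_apply']
    exact growth_le_growth hP hQ hA (growth_iterate_nonneg hA e hK) ih

theorem growth_iterate_mono (hA : 0 ≤ A) {K : ℝ} (hK : 0 ≤ K) :
    Monotone fun e : ℕ => (growth P Q A)^[e] K :=
  monotone_nat_of_le_succ fun e => by
    rw [Function.iterate_succ_apply']; exact le_growth hA (growth_iterate_nonneg hA e hK)

theorem add_mul_signedPow_le_growth (hP : 1 < P) (hQ : 1 < Q) {S x y K : ℝ} (hS : 0 ≤ S)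
    (hSA : S ≤ A) (hy : 0 ≤ y) (hxK : x ≤ K) (hyK : y ≤ K) :
    x + S * signedPow P y ≤ growth P Q A K ∧ x + S * signedPow Q y ≤ growth P Q A K := by
  have hA := hS.trans hSA
  have h1 := mul_le_mul hSA (signedPow_le_signedPow hP hy hyK) (signedPow_nonneg hy) hA
  have h2 := mul_le_mul hSA (signedPow_le_signedPow hQ hy hyK) (signedPow_nonneg hy) hA
  have h3 := mul_nonneg hA (signedPow_nonneg (P := P) (hy.trans hyK))
  have h4 := mul_nonneg hA (signedPow_nonneg (P := Q) (hy.trans hyK))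
  rw [growth]
  exact ⟨by linarith, by linarith⟩

/-- Staying in one quadrant costs one application of `growth`. Each further quadrant costs two: one
for the kick that enters it and one for the passage inside it. The induction splits at the first
index `x` beyond the first `d + 1` quadrants. -/
theorem iterate_growth_chain (hP : 1 < P) (hQ : 1 < Q) (hA : 0 ≤ A) {L : ℕ} {κ : ℕ → ℕ}
    {ν : ℕ → ℝ} (hκ : Monotone κ) (hν : ∀ j, 0 ≤ ν j)
    (hsame : ∀ i j, i ≤ j → j ≤ L → κ i = κ j →
      ν j ≤ growth P Q A (ν i) ∧ ν i ≤ growth P Q A (ν j))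
    (hadj : ∀ j < L, ν (j + 1) ≤ growth P Q A (ν j) ∧ ν j ≤ growth P Q A (ν (j + 1)))
    (d : ℕ) : ∀ i j, i ≤ j → j ≤ L → κ j ≤ κ i + d →
      ν j ≤ (growth P Q A)^[2 * d + 1] (ν i) ∧ ν i ≤ (growth P Q A)^[2 * d + 1] (ν j) := by
  induction d with
  | zero =>
    intro i j hij hj hd
    exact hsame i j hij hj (le_antisymm (hκ hij) hd)
  | succ d ih =>
    intro i j hij hj hd
    by_cases hlt : κ j ≤ κ i + d
    · obtain ⟨h1, h2⟩ := ih i j hij hj hlt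
      exact ⟨h1.trans (growth_iterate_mono hA (hν i) (by omega)),
        h2.trans (growth_iterate_mono hA (hν j) (by omega))⟩
    have hex : ∃ x, κ i + d < κ x := ⟨j, by omega⟩
    classical
    set x := Nat.find hex with hx
    have hxs : κ i + d < κ x := Nat.find_spec hex
    have hxj : x ≤ j := Nat.find_min' hex (by omega)
    have hix : i < x := by
      by_contra! hc
      have := hκ hc
      omega
    have hpred : κ (x - 1) ≤ κ i + d := not_lt.1 (Nat.find_min hex (by omega))
    obtain ⟨h1, h2⟩ := ih i (x - 1) (by omega) (by omega) hpred
    have hκx : κ x = κ j := by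
      have := hκ hxj
      omega
    obtain ⟨h3, h4⟩ := hadj (x - 1) (by omega)
    rw [show x - 1 + 1 = x by omega] at h3 h4
    obtain ⟨h5, h6⟩ := hsame x j hxj hj hκx
    constructor
    · rw [show 2 * (d + 1) + 1 = 2 * d + 1 + 1 + 1 by ring, Function.iterate_succ_apply',
        Function.iterate_succ_apply']
      exact h5.trans (growth_le_growth hP hQ hA (hν x)
        (h3.trans (growth_le_growth hP hQ hA (hν _) h1)))
    · rw [show 2 * (d + 1) + 1 = 2 * d + 1 + 1 + 1 by ring, Function.iterate_succ_apply,
        Function.iterate_succ_apply]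
      exact h2.trans (growth_iterate_le hP hQ hA _ (hν _)
        (h4.trans (growth_le_growth hP hQ hA (hν x) h6)))

end growth

theorem IsKick.growth_bound {P Q A : ℝ} {m l F G : ℕ → ℝ} {κ : ℕ → ℕ} {n L : ℕ}
    (h : IsKick P Q m l F G) (hw : IsWinding n L κ F G) (hP : 1 < P) (hQ : 1 < Q)
    (hm : ∀ j, 0 ≤ m j) (hl : ∀ j, 0 ≤ l j) (hml : ∀ j, m j * l j = 0)
    (hmA : ∑ j ∈ Finset.range L, m j ≤ A) (hlA : ∑ j ∈ Finset.range L, l j ≤ A)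
    {M : ℕ} (hM : M ≤ L) (j : ℕ) (hj : j ≤ L) :
    max |F j| |G j| ≤ (growth P Q A)^[4 * n + 3] (max |F M| |G M|) := by
  have hA : 0 ≤ A := (Finset.sum_nonneg fun j _ => hm j).trans hmA
  have hsub : ∀ {f : ℕ → ℝ}, (∀ j, 0 ≤ f j) → (∑ j ∈ Finset.range L, f j ≤ A) → ∀ i j, j ≤ L →
      0 ≤ ∑ x ∈ Finset.Ico i j, f x ∧ ∑ x ∈ Finset.Ico i j, f x ≤ A := fun hf hfA i j hj =>
    ⟨Finset.sum_nonneg fun x _ => hf x, (Finset.sum_le_sum_of_subset_of_nonneg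
      (fun x hx => by simp only [Finset.mem_Ico, Finset.mem_range] at hx ⊢; omega)
      fun x _ _ => hf x).trans hfA⟩
  have hν : ∀ j, 0 ≤ max |F j| |G j| := fun j => le_max_of_le_left (abs_nonneg _)
  have key := iterate_growth_chain hP hQ hA (L := L) hw.mono hν ?_ ?_ (2 * n + 1)
  · rw [show 2 * (2 * n + 1) + 1 = 4 * n + 3 by ring] at key
    have hb : ∀ j ≤ L, κ j ≤ 2 * n + 1 := fun j hj => hw.last ▸ hw.mono hj
    rcases le_total M j with h1 | h1
    · exact (key M j h1 hj (by have := hb j hj; omega)).1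
    · exact (key j M h1 hM (by have := hb M hM; omega)).2
  · intro i j hij hj hκ
    have hconst : ∀ x, i ≤ x → x ≤ j → κ x = κ i := fun x h1 h2 =>
      le_antisymm ((hw.mono h2).trans hκ.ge) (hw.mono h1)
    obtain ⟨hm1, hm2⟩ := hsub hm hmA i j hj
    obtain ⟨hl1, hl2⟩ := hsub hl hlA i j hj
    have bd : ∀ {x y S : ℝ} (i), 0 ≤ S → S ≤ A → 0 ≤ y → x ≤ max |F i| |G i| →
        y ≤ max |F i| |G i| → x + S * signedPow P y ≤ growth P Q A (max |F i| |G i|) ∧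
          x + S * signedPow Q y ≤ growth P Q A (max |F i| |G i|) := fun i h1 h2 h3 h4 h5 =>
      add_mul_signedPow_le_growth hP hQ h1 h2 h3 h4 h5
    have hFi := le_max_left |F i| |G i|
    have hGi := le_max_right |F i| |G i|
    have hFj := le_max_left |F j| |G j|
    have hGj := le_max_right |F j| |G j|
    have gi := le_growth (P := P) (Q := Q) hA (hν i)
    have gj := le_growth (P := P) (Q := Q) hA (hν j)
    have f1 := (bd i hm1 hm2 (abs_nonneg (G i)) hFi hGi).1
    have f2 := (bd i hl1 hl2 (abs_nonneg (F i)) hGi hFi).2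
    have f3 := (bd j hm1 hm2 (abs_nonneg (G j)) hFj hGj).1
    have f4 := (bd j hl1 hl2 (abs_nonneg (F j)) hGj hFj).2
    obtain ⟨k, hk | hk⟩ := Nat.even_or_odd' (κ i)
    · obtain ⟨b1, b2, b3, b4⟩ := h.bounds_of_even hP hQ hm hl hij (k := k) fun x h1 h2 => by
        rw [← hk, ← hconst x h1 h2]; exact hw.mem x
      have p1 := mul_nonneg hm1 (signedPow_nonneg (P := P) (abs_nonneg (G j)))
      have p2 := mul_nonneg hl1 (signedPow_nonneg (P := Q) (abs_nonneg (F i)))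
      exact ⟨max_le (by linarith) (by linarith), max_le (by linarith) (by linarith)⟩
    · obtain ⟨b1, b2, b3, b4⟩ := h.bounds_of_odd hP hQ hm hl hij (k := k) fun x h1 h2 => by
        rw [← hk, ← hconst x h1 h2]; exact hw.mem x
      have p1 := mul_nonneg hm1 (signedPow_nonneg (P := P) (abs_nonneg (G i)))
      have p2 := mul_nonneg hl1 (signedPow_nonneg (P := Q) (abs_nonneg (F j)))
      exact ⟨max_le (by linarith) (by linarith), max_le (by linarith) (by linarith)⟩
  · intro j hj
    obtain ⟨hm1, hm2⟩ := hsub hm hmA j (j + 1) hj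
    obtain ⟨hl1, hl2⟩ := hsub hl hlA j (j + 1) hj
    rw [Nat.Ico_succ_singleton, Finset.sum_singleton] at hm1 hm2 hl1 hl2
    have e1 : ∀ x y S : ℝ, 0 ≤ S → |x + S * signedPow P y| ≤ |x| + S * signedPow P |y| :=
      fun x y S hS => (abs_add_le _ _).trans_eq (by
        rw [abs_mul, abs_of_nonneg hS, signedPow_abs hP])
    have e2 : ∀ x y S : ℝ, 0 ≤ S → |x - S * signedPow Q y| ≤ |x| + S * signedPow Q |y| :=
      fun x y S hS => (abs_sub _ _).trans_eq (by
        rw [abs_mul, abs_of_nonneg hS, signedPow_abs hQ])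
    have e3 : ∀ x y S : ℝ, 0 ≤ S → |x - S * signedPow P y| ≤ |x| + S * signedPow P |y| :=
      fun x y S hS => (abs_sub _ _).trans_eq (by
        rw [abs_mul, abs_of_nonneg hS, signedPow_abs hP])
    have e4 : ∀ x y S : ℝ, 0 ≤ S → |x + S * signedPow Q y| ≤ |x| + S * signedPow Q |y| :=
      fun x y S hS => (abs_add_le _ _).trans_eq (by
        rw [abs_mul, abs_of_nonneg hS, signedPow_abs hQ])
    -- A kick is undone by the opposite kick: the coordinate that drives it did not move, so it may
    -- be read at `j + 1`.
    have hF : F j = F (j + 1) - m j * signedPow P (G (j + 1)) := by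
      rw [h.fst_succ, h.snd_succ]
      rcases mul_eq_zero.1 (hml j) with h0 | h0 <;> simp [h0]
    have hG : G j = G (j + 1) + l j * signedPow Q (F (j + 1)) := by
      rw [h.fst_succ, h.snd_succ]
      rcases mul_eq_zero.1 (hml j) with h0 | h0 <;> simp [h0]
    refine ⟨max_le ?_ ?_, max_le ?_ ?_⟩
    · rw [h.fst_succ]
      exact (e1 _ _ _ hm1).trans (add_mul_signedPow_le_growth hP hQ hm1 hm2 (abs_nonneg _)
        (le_max_left _ _) (le_max_right _ _)).1
    · rw [h.snd_succ]
      exact (e2 _ _ _ hl1).trans (add_mul_signedPow_le_growth hP hQ hl1 hl2 (abs_nonneg _)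
        (le_max_right _ _) (le_max_left _ _)).2
    · rw [hF]
      exact (e3 _ _ _ hm1).trans (add_mul_signedPow_le_growth hP hQ hm1 hm2 (abs_nonneg _)
        (le_max_left _ _) (le_max_right _ _)).1
    · rw [hG]
      exact (e4 _ _ _ hl1).trans (add_mul_signedPow_le_growth hP hQ hl1 hl2 (abs_nonneg _)
        (le_max_right _ _) (le_max_left _ _)).2

/-- The first index at which the quadrant index reaches `k`. -/
noncomputable def hit (κ : ℕ → ℕ) (k : ℕ) : ℕ := sInf {j | k ≤ κ j}

/-! ### Hitting indices, the longest quadrant and the normalisation. -/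

namespace IsWinding

variable {n L : ℕ} {κ : ℕ → ℕ} {F G : ℕ → ℝ}

theorem hit_le_iff (h : IsWinding n L κ F G) {k : ℕ} (hk : k ≤ 2 * n + 1) (j : ℕ) :
    hit κ k ≤ j ↔ k ≤ κ j := by
  have hne : {j | k ≤ κ j}.Nonempty := ⟨L, by simpa [h.last] using hk⟩
  have hmem : k ≤ κ (hit κ k) := by rw [hit]; simpa using Nat.sInf_mem hne
  exact ⟨fun hj => hmem.trans (h.mono hj), fun hj => Nat.sInf_le hj⟩

theorem lt_hit_iff (h : IsWinding n L κ F G) {k : ℕ} (hk : k ≤ 2 * n + 1) (j : ℕ) :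
    j < hit κ k ↔ κ j < k := by
  rw [← not_le, h.hit_le_iff hk, not_le]

theorem hit_zero : hit κ 0 = 0 := by
  rw [hit, Nat.sInf_eq_zero]; left; simp

theorem hit_last (h : IsWinding n L κ F G) : hit κ (2 * n + 1) = L := by
  refine le_antisymm ((h.hit_le_iff le_rfl L).2 h.last.ge) ?_
  by_contra! hlt
  have := (h.hit_le_iff le_rfl _).1 le_rfl
  have := h.lt _ hlt
  omega

theorem hit_le_hit (h : IsWinding n L κ F G) {k k' : ℕ} (hk : k ≤ k') (hk' : k' ≤ 2 * n + 1) :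
    hit κ k ≤ hit κ k' :=
  (h.hit_le_iff (hk.trans hk') _).2 (hk.trans ((h.hit_le_iff hk' _).1 le_rfl))

theorem hit_le (h : IsWinding n L κ F G) {k : ℕ} (hk : k ≤ 2 * n + 1) : hit κ k ≤ L :=
  h.hit_last ▸ h.hit_le_hit hk le_rfl

theorem apply_eq (h : IsWinding n L κ F G) {k : ℕ} (hk : k ≤ 2 * n) {j : ℕ} (h1 : hit κ k ≤ j)
    (h2 : j < hit κ (k + 1)) : κ j = k := by
  have := (h.hit_le_iff (by omega) _).1 h1
  have := (h.lt_hit_iff (by omega) _).1 h2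
  omega

theorem hit_pos (h : IsWinding n L κ F G) {k : ℕ} (hk : k ≤ 2 * n) : 0 < hit κ (k + 1) := by
  rw [h.lt_hit_iff (by omega), h.start]; omega

theorem apply_pred_hit (h : IsWinding n L κ F G) {k : ℕ} (hk : k ≤ 2 * n) :
    κ (hit κ (k + 1) - 1) = k ∧ κ (hit κ (k + 1)) = k + 1 := by
  have h0 := h.hit_pos hk
  have h1 := (h.hit_le_iff (k := k + 1) (by omega) _).1 le_rfl
  have h2 := (h.lt_hit_iff (k := k + 1) (by omega) (hit κ (k + 1) - 1)).1 (by omega)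
  have h3 := h.step (hit κ (k + 1) - 1)
  rw [show hit κ (k + 1) - 1 + 1 = hit κ (k + 1) by omega] at h3
  omega

/-- Pigeonhole: `2n + 1` passages fill `L` indices. -/
theorem exists_long (h : IsWinding n L κ F G) :
    ∃ k ≤ 2 * n, L ≤ (2 * n + 1) * (hit κ (k + 1) - hit κ k) := by
  by_contra! hc
  have key : ∀ k ≤ 2 * n + 1, (2 * n + 1) * hit κ k + k ≤ k * L := fun k => by
    induction k with
    | zero => intro _; simp [hit_zero]
    | succ k ih =>
      intro hk
      have h1 := ih (by omega)
      have h2 := hc k (by omega)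
      have h3 := h.hit_le_hit (show k ≤ k + 1 by omega) hk
      obtain ⟨d, hd⟩ := Nat.exists_eq_add_of_le h3
      rw [hd, Nat.add_sub_cancel_left] at h2
      rw [hd, mul_add, add_mul k 1 L, one_mul]
      omega
  have := key (2 * n + 1) le_rfl
  rw [h.hit_last] at this
  omega

theorem rescale (h : IsWinding n L κ F G) {A B : ℝ} (hA : 0 < A) (hB : 0 < B) :
    IsWinding n L κ (fun j => F j / A) (fun j => G j / B) where
  fst_zero := by simp [h.fst_zero]
  snd_last := by simp [h.snd_last]
  ne_zero j := (h.ne_zero j).imp (fun h => div_ne_zero h hA.ne') fun h => div_ne_zero h hB.ne'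
  mono := h.mono
  start := h.start
  step := h.step
  lt := h.lt
  last := h.last
  mem j := by
    obtain ⟨h1, h2⟩ := h.mem j
    exact ⟨by rw [← mul_div_assoc]; exact div_nonneg h1 hA.le,
      by rw [← mul_div_assoc]; exact div_nonneg h2 hB.le⟩

end IsWinding

/-- At the middle `M` of the longest quadrant both parts carry mass at least `μ`. Hence `c μ φ_P(|G
M|) ≤ |F M|` and `μ φ_Q(|F M|) ≤ |G M|`. After dividing `F` by `|F M|` and `G` by `|G M|`, these are
exactly the bounds `c₁, c₂ ≤ 1 / μ`. -/
theorem exists_bounded_winding {P Q : ℝ} (hP : 1 < P) (hQ : 1 < Q) {m l : ℕ → ℝ}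
    (hm : ∀ k, 0 < m (2 * k)) (hm' : ∀ k, m (2 * k + 1) = 0)
    (hl : ∀ k, 0 < l (2 * k + 1)) (hl' : ∀ k, l (2 * k) = 0) {n N : ℕ} (hN : n < N) {A μ : ℝ}
    (hμ : 0 < μ) (hmA : ∑ j ∈ Finset.range (2 * N), m j ≤ A)
    (hlA : ∑ j ∈ Finset.range (2 * N), l j ≤ A)
    (hlong : ∀ i j, i ≤ j → j ≤ 2 * N → N ≤ (2 * n + 1) * (j - i + 1) →
      μ ≤ ∑ x ∈ Finset.Ico i j, m x ∧ μ ≤ ∑ x ∈ Finset.Ico i j, l x) :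
    ∃ c₁ ∈ Set.Icc 0 (1 / μ), ∃ c₂ ∈ Set.Icc 0 (1 / μ), ∃ (F G : ℕ → ℝ) (κ : ℕ → ℕ),
      IsKick P Q (fun j => c₁ * m j) (fun j => c₂ * l j) F G ∧ IsWinding n (2 * N) κ F G ∧
      (∃ M ≤ 2 * N, |F M| = 1 ∧ |G M| = 1) ∧
      ∀ j ≤ 2 * N, |F j| ≤ (growth P Q (1 / μ * A))^[4 * n + 3] 1 ∧
        |G j| ≤ (growth P Q (1 / μ * A))^[4 * n + 3] 1 := by
  obtain ⟨c, hc, F, G, κ, h, hw⟩ := exists_isWinding hP hQ hm hm' hl hl' n N hN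
  have hm0 : ∀ j, 0 ≤ m j := fun j => by
    rcases Nat.even_or_odd' j with ⟨i, rfl | rfl⟩
    exacts [(hm i).le, (hm' i).ge]
  have hl0 : ∀ j, 0 ≤ l j := fun j => by
    rcases Nat.even_or_odd' j with ⟨i, rfl | rfl⟩
    exacts [(hl' i).ge, (hl i).le]
  have hml : ∀ j, m j * l j = 0 := fun j => by
    rcases Nat.even_or_odd' j with ⟨i, rfl | rfl⟩
    · simp [hl']
    · simp [hm']
  obtain ⟨k, hk, hlen⟩ := hw.exists_long
  set I := hit κ k with hI
  set D := hit κ (k + 1) - I with hD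
  have hle : hit κ (k + 1) ≤ 2 * N := hw.hit_le (by omega)
  have hDpos : 0 < D := by
    rcases Nat.eq_zero_or_pos D with h0 | h0
    · rw [h0] at hlen; omega
    · exact h0
  set M := I + D / 2 with hM
  have hMle : M ≤ 2 * N := by omega
  have hbig : ∀ d, D ≤ 2 * (d + 1) → N ≤ (2 * n + 1) * (d + 1) := fun d hd => by
    have := Nat.mul_le_mul_left (2 * n + 1) hd
    rw [mul_left_comm] at this
    omega
  obtain ⟨a1, a2⟩ := hlong I M (by omega) hMle (by
    rw [show M - I = D / 2 by omega]; exact hbig _ (by omega))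
  -- The right part stops at `I + D - 1`, because `I + D` already belongs to the next quadrant.
  obtain ⟨a3, a4⟩ := hlong M (I + D - 1) (by omega) (by omega) (by
    rw [show I + D - 1 - M = D - 1 - D / 2 by omega]; exact hbig _ (by omega))
  obtain ⟨d1, d2⟩ := h.mid_bounds hP hQ (fun j => mul_nonneg hc.le (hm0 j)) hl0
    (show I ≤ M by omega) (show M ≤ I + D - 1 by omega) (k := k) fun x h1 h2 => by
      have := hw.mem x
      rwa [hw.apply_eq hk h1 (by omega)] at this
  rw [← Finset.mul_sum, ← Finset.mul_sum] at d1
  have hFP : (0 : ℝ) ≤ signedPow P |G M| := signedPow_nonneg (abs_nonneg _)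
  have hGQ : (0 : ℝ) ≤ signedPow Q |F M| := signedPow_nonneg (abs_nonneg _)
  have d1' : c * μ * signedPow P |G M| ≤ |F M| :=
    (mul_le_mul_of_nonneg_right (le_min (mul_le_mul_of_nonneg_left a1 hc.le)
      (mul_le_mul_of_nonneg_left a3 hc.le)) hFP).trans d1
  have d2' : μ * signedPow Q |F M| ≤ |G M| :=
    (mul_le_mul_of_nonneg_right (le_min a2 a4) hGQ).trans d2
  have hFM : 0 < |F M| := by
    rcases hw.ne_zero M with h0 | h0
    · exact abs_pos.2 h0
    · exact (mul_pos (mul_pos hc hμ) (signedPow_pos (abs_pos.2 h0))).trans_le d1'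
  have hGM : 0 < |G M| := (mul_pos hμ (signedPow_pos hFM)).trans_le d2'
  have hk' := h.rescale hFM.ne' hGM.ne'
  have hw' := hw.rescale hFM hGM
  have hc1 : c * signedPow P |G M| / |F M| ∈ Set.Icc 0 (1 / μ) := by
    refine ⟨div_nonneg (mul_nonneg hc.le hFP) hFM.le, ?_⟩
    rw [div_le_div_iff₀ hFM hμ]; linarith
  have hc2 : signedPow Q |F M| / |G M| ∈ Set.Icc 0 (1 / μ) := by
    refine ⟨div_nonneg hGQ hGM.le, ?_⟩
    rw [div_le_div_iff₀ hGM hμ]; linarith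
  have e1 : |F M / (|F M|)| = 1 := by rw [abs_div, abs_abs, div_self hFM.ne']
  have e2 : |G M / (|G M|)| = 1 := by rw [abs_div, abs_abs, div_self hGM.ne']
  refine ⟨_, hc1, _, hc2, _, _, κ, hk', hw', ⟨M, hMle, e1, e2⟩, fun j hj => ?_⟩
  have hμ' : 0 ≤ 1 / μ := by positivity
  have hb := hk'.growth_bound hw' hP hQ (A := 1 / μ * A) (fun j => mul_nonneg hc1.1 (hm0 j))
    (fun j => mul_nonneg hc2.1 (hl0 j)) (fun j => by rw [mul_mul_mul_comm, hml, mul_zero])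
    (by rw [← Finset.mul_sum]
        exact mul_le_mul hc1.2 hmA (Finset.sum_nonneg fun j _ => hm0 j) hμ')
    (by rw [← Finset.mul_sum]
        exact mul_le_mul hc2.2 hlA (Finset.sum_nonneg fun j _ => hl0 j) hμ') hMle j hj
  rw [e1, e2, max_self] at hb
  exact max_le_iff.1 hb

end HardySystem

namespace HardySystem

open Filter Topology

/-! ### Discretisation of weights -/

/-- A positive weight on the line, integrable over bounded intervals. -/
structure IsWeight (U : ℝ → ℝ) : Prop where
  pos : ∀ x, 0 < U x
  int : ∀ x y, IntervalIntegrable U volume x y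

namespace IsWeight

variable {U : ℝ → ℝ}

theorem integral_pos (hU : IsWeight U) {x y : ℝ} (h : x < y) : 0 < ∫ t in x..y, U t :=
  intervalIntegral.intervalIntegral_pos_of_pos (hU.int x y) hU.pos h

theorem integral_nonneg (hU : IsWeight U) {x y : ℝ} (h : x ≤ y) : 0 ≤ ∫ t in x..y, U t :=
  intervalIntegral.integral_nonneg h fun t _ => (hU.pos t).le

theorem integral_mono (hU : IsWeight U) {w x y z : ℝ} (hwx : w ≤ x) (hyz : y ≤ z) :
    ∫ t in x..y, U t ≤ ∫ t in w..z, U t := by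
  have h1 := intervalIntegral.integral_add_adjacent_intervals (hU.int w x) (hU.int x y)
  have h2 := intervalIntegral.integral_add_adjacent_intervals (hU.int w y) (hU.int y z)
  have h3 := hU.integral_nonneg hwx
  have h4 := hU.integral_nonneg hyz
  linarith

/-- The mass of a window of width `δ` is a continuous positive function of its position, so it has a
positive minimum on a compact interval. -/
theorem exists_pos_le_integral (hU : IsWeight U) {a b δ : ℝ} (hab : a ≤ b) (hδ : 0 < δ) :
    ∃ μ > 0, ∀ x y, a ≤ x → y ≤ b → x + δ ≤ y → μ ≤ ∫ t in x..y, U t := by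
  have hc := intervalIntegral.continuous_primitive hU.int a
  have hc' : Continuous fun x => ∫ t in x..x + δ, U t := by
    have : (fun x => ∫ t in x..x + δ, U t) =
        fun x => (∫ t in a..x + δ, U t) - ∫ t in a..x, U t := by
      funext x
      rw [intervalIntegral.integral_interval_sub_left (hU.int _ _) (hU.int _ _)]
    rw [this]
    exact (hc.comp (continuous_id.add continuous_const)).sub hc
  obtain ⟨x₀, -, hx₀⟩ := isCompact_Icc.exists_isMinOn (Set.nonempty_Icc.2 hab) hc'.continuousOn
  refine ⟨_, hU.integral_pos (x := x₀) (y := x₀ + δ) (by linarith), fun x y hx hy hxy => ?_⟩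
  exact (hx₀ (Set.mem_Icc.2 ⟨hx, by linarith⟩)).trans
    (hU.integral_mono le_rfl hxy)

end IsWeight

/-- The nodes of the uniform subdivision of `[a, b]` into `2N` intervals. -/
noncomputable def grid (a b : ℝ) (N j : ℕ) : ℝ := a + (b - a) * (j / (2 * N))

/-- Masses of a weight over double cells, placed at even indices. -/
noncomputable def massEven (U : ℝ → ℝ) (a b : ℝ) (N j : ℕ) : ℝ :=
  if Even j then ∫ t in grid a b N j..grid a b N (j + 2), U t else 0

/-- Masses of a weight over double cells, placed at odd indices. -/
noncomputable def massOdd (V : ℝ → ℝ) (a b : ℝ) (N j : ℕ) : ℝ :=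
  if Even j then 0 else ∫ t in grid a b N (j - 1)..grid a b N (j + 1), V t

section grid

variable {a b : ℝ} {N : ℕ} {U : ℝ → ℝ}

theorem grid_zero : grid a b N 0 = a := by simp [grid]

theorem grid_last (hN : 0 < N) : grid a b N (2 * N) = b := by
  have : (N : ℝ) ≠ 0 := by positivity
  rw [grid]; push_cast; field_simp; ring

theorem grid_sub (i j : ℕ) : grid a b N j - grid a b N i = (b - a) * ((j - i) / (2 * N)) := by
  rw [grid, grid]; ring

theorem grid_mono (hab : a < b) : Monotone (grid a b N) := fun i j hij => by
  have h := grid_sub (a := a) (b := b) (N := N) i j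
  have h1 : (i : ℝ) ≤ j := by exact_mod_cast hij
  have : 0 ≤ (b - a) * (((j : ℝ) - i) / (2 * N)) :=
    mul_nonneg (by linarith) (div_nonneg (by linarith) (by positivity))
  linarith

theorem grid_lt (hab : a < b) (hN : 0 < N) {i j : ℕ} (hij : i < j) :
    grid a b N i < grid a b N j := by
  have h := grid_sub (a := a) (b := b) (N := N) i j
  have h1 : (i : ℝ) < j := by exact_mod_cast hij
  have : 0 < (b - a) * (((j : ℝ) - i) / (2 * N)) :=
    mul_pos (by linarith) (div_pos (by linarith) (by positivity))
  linarith

theorem grid_mem (hab : a < b) (hN : 0 < N) {j : ℕ} (hj : j ≤ 2 * N) :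
    grid a b N j ∈ Set.Icc a b :=
  ⟨by simpa [grid_zero] using grid_mono (N := N) hab (Nat.zero_le j),
    by simpa [grid_last hN] using grid_mono (N := N) hab hj⟩

theorem sum_massEven (hU : IsWeight U) (J : ℕ) : ∑ j ∈ Finset.range J, massEven U a b N j =
    ∫ t in a..grid a b N (2 * ((J + 1) / 2)), U t := by
  induction J with
  | zero => simp [grid_zero]
  | succ J ih =>
    rw [Finset.sum_range_succ, ih]
    rcases Nat.even_or_odd' J with ⟨i, rfl | rfl⟩
    · rw [massEven, if_pos (even_two_mul i), show (2 * i + 1) / 2 = i by omega,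
        show (2 * i + 1 + 1) / 2 = i + 1 by omega,
        intervalIntegral.integral_add_adjacent_intervals (hU.int _ _) (hU.int _ _), mul_add]
    · rw [massEven, if_neg (by simp), add_zero, show (2 * i + 1 + 1) / 2 = i + 1 by omega,
        show (2 * i + 1 + 1 + 1) / 2 = i + 1 by omega]

theorem sum_massOdd (hU : IsWeight U) (J : ℕ) : ∑ j ∈ Finset.range J, massOdd U a b N j =
    ∫ t in a..grid a b N (2 * (J / 2)), U t := by
  induction J with
  | zero => simp [grid_zero]
  | succ J ih =>
    rw [Finset.sum_range_succ, ih]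
    rcases Nat.even_or_odd' J with ⟨i, rfl | rfl⟩
    · rw [massOdd, if_pos (even_two_mul i), show (2 * i + 1) / 2 = i by omega,
        show (2 * i) / 2 = i by omega, add_zero]
    · rw [massOdd, if_neg (by simp), show (2 * i + 1) / 2 = i by omega,
        show (2 * i + 1 + 1) / 2 = i + 1 by omega, Nat.add_sub_cancel,
        intervalIntegral.integral_add_adjacent_intervals (hU.int _ _) (hU.int _ _), mul_add]

theorem sum_Ico_massEven (hU : IsWeight U) {i j : ℕ} (hij : i ≤ j) :
    ∑ x ∈ Finset.Ico i j, massEven U a b N x =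
      ∫ t in grid a b N (2 * ((i + 1) / 2))..grid a b N (2 * ((j + 1) / 2)), U t := by
  rw [Finset.sum_Ico_eq_sub _ hij, sum_massEven hU, sum_massEven hU,
    intervalIntegral.integral_interval_sub_left (hU.int _ _) (hU.int _ _)]

theorem sum_Ico_massOdd (hU : IsWeight U) {i j : ℕ} (hij : i ≤ j) :
    ∑ x ∈ Finset.Ico i j, massOdd U a b N x =
      ∫ t in grid a b N (2 * (i / 2))..grid a b N (2 * (j / 2)), U t := by
  rw [Finset.sum_Ico_eq_sub _ hij, sum_massOdd hU, sum_massOdd hU,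
    intervalIntegral.integral_interval_sub_left (hU.int _ _) (hU.int _ _)]

theorem massEven_pos (hU : IsWeight U) (hab : a < b) (hN : 0 < N) (k : ℕ) :
    0 < massEven U a b N (2 * k) := by
  rw [massEven, if_pos (even_two_mul k)]
  exact hU.integral_pos (grid_lt hab hN (by omega))

theorem massEven_odd (k : ℕ) : massEven U a b N (2 * k + 1) = 0 := by simp [massEven]

theorem massOdd_pos (hU : IsWeight U) (hab : a < b) (hN : 0 < N) (k : ℕ) :
    0 < massOdd U a b N (2 * k + 1) := by
  rw [massOdd, if_neg (by simp)]
  exact hU.integral_pos (grid_lt hab hN (by omega))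

theorem massOdd_even (k : ℕ) : massOdd U a b N (2 * k) = 0 := by simp [massOdd]

end grid

theorem exists_discrete_winding {P Q : ℝ} (hP : 1 < P) (hQ : 1 < Q) {a b : ℝ} (hab : a < b)
    {U V : ℝ → ℝ} (hU : IsWeight U) (hV : IsWeight V) (n : ℕ) :
    ∃ (N₀ : ℕ) (C : ℝ), 0 < N₀ ∧ ∀ N ≥ N₀, ∃ c₁ ∈ Set.Icc 0 C, ∃ c₂ ∈ Set.Icc 0 C,
      ∃ (F G : ℕ → ℝ) (κ : ℕ → ℕ) (M : ℕ),
      IsKick P Q (fun j => c₁ * massEven U a b N j) (fun j => c₂ * massOdd V a b N j) F G ∧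
      IsWinding n (2 * N) κ F G ∧ M ≤ 2 * N ∧ |F M| = 1 ∧ |G M| = 1 ∧
      ∀ j ≤ 2 * N, |F j| ≤ C ∧ |G j| ≤ C := by
  -- A long half-passage has about `N / (2n+1)` indices. Rounding its ends to even nodes loses a
  -- bounded number of them, at most half once `N ≥ 4(2n+1)`. The mesh is `(b - a) / (2N)`, which
  -- gives the length `δ`.
  set δ := (b - a) / (4 * (2 * n + 1)) with hδ
  have hδ0 : 0 < δ := div_pos (by linarith) (by positivity)
  obtain ⟨μ₁, hμ₁, h₁⟩ := hU.exists_pos_le_integral hab.le hδ0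
  obtain ⟨μ₂, hμ₂, h₂⟩ := hV.exists_pos_le_integral hab.le hδ0
  set μ := min μ₁ μ₂ with hμ
  have hμ0 : 0 < μ := lt_min hμ₁ hμ₂
  set A := max (∫ t in a..b, U t) (∫ t in a..b, V t) with hA
  refine ⟨4 * (2 * n + 1), max (1 / μ) ((growth P Q (1 / μ * A))^[4 * n + 3] 1), by omega,
    fun N hN => ?_⟩
  have hN0 : 0 < N := by omega
  have hNr : (4 * (2 * n + 1) : ℝ) ≤ N := by exact_mod_cast hN
  have hNr0 : (0 : ℝ) < N := by exact_mod_cast hN0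
  have hgap : ∀ i j i' j' : ℕ, i ≤ j → N ≤ (2 * n + 1) * (j - i + 1) → j - i ≤ j' - i' + 1 →
      i' ≤ j' → grid a b N i' + δ ≤ grid a b N j' := fun i j i' j' hij hlen hle hij' => by
    have e := grid_sub (a := a) (b := b) (N := N) i' j'
    have hcast : (N : ℝ) ≤ (2 * n + 1) * ((j' - i') + 2) := by
      have : N ≤ (2 * n + 1) * ((j' - i') + 2) :=
        hlen.trans (Nat.mul_le_mul_left _ (by omega))
      have h3 : (N : ℝ) ≤ (2 * n + 1) * (((j' - i' : ℕ) : ℝ) + 2) := by exact_mod_cast this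
      rwa [Nat.cast_sub hij'] at h3
    have : 1 / (4 * (2 * (n : ℝ) + 1)) ≤ ((j' : ℝ) - i') / (2 * N) := by
      rw [div_le_div_iff₀ (by positivity) (by positivity)]
      nlinarith
    have h4 := mul_le_mul_of_nonneg_left this (by linarith : 0 ≤ b - a)
    have h5 : δ = (b - a) * (1 / (4 * (2 * (n : ℝ) + 1))) := by rw [hδ]; ring
    linarith
  obtain ⟨c₁, hc₁, c₂, hc₂, F, G, κ, hk, hw, ⟨M, hM, hFM, hGM⟩, hb⟩ :=
    exists_bounded_winding hP hQ (massEven_pos hU hab hN0) massEven_odd (massOdd_pos hV hab hN0)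
      massOdd_even (n := n) (N := N) (by omega) (A := A) hμ0
      (by rw [sum_massEven hU, show 2 * ((2 * N + 1) / 2) = 2 * N by omega, grid_last hN0]
          exact le_max_left _ _)
      (by rw [sum_massOdd hV, show 2 * (2 * N / 2) = 2 * N by omega, grid_last hN0]
          exact le_max_right _ _)
      (fun i j hij hj hlen => by
        rw [sum_Ico_massEven hU hij, sum_Ico_massOdd hV hij]
        exact ⟨(min_le_left _ _).trans (h₁ _ _ (grid_mem hab hN0 (by omega)).1
            (grid_mem hab hN0 (by omega)).2 (hgap i j _ _ hij hlen (by omega) (by omega))),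
          (min_le_right _ _).trans (h₂ _ _ (grid_mem hab hN0 (by omega)).1
            (grid_mem hab hN0 (by omega)).2 (hgap i j _ _ hij hlen (by omega) (by omega)))⟩)
  exact ⟨c₁, ⟨hc₁.1, hc₁.2.trans (le_max_left _ _)⟩, c₂, ⟨hc₂.1, hc₂.2.trans (le_max_left _ _)⟩,
    F, G, κ, M, hk, hw, hM, hFM, hGM, fun j hj => ⟨(hb j hj).1.trans (le_max_right _ _),
      (hb j hj).2.trans (le_max_right _ _)⟩⟩

end HardySystem

namespace HardySystem

open Filter Topology

/-! ### Interpolation and passage to the limit -/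

/-- Arzelà–Ascoli. The common modulus of continuity is supplied by one function `W`, in practice a
multiple of the primitive of a weight. -/
theorem exists_tendstoUniformlyOn_subseq {a b C : ℝ} (hab : a ≤ b) {f : ℕ → ℝ → ℝ} {W : ℝ → ℝ}
    (hW : Continuous W) (hC : ∀ k, ∀ x ∈ Set.Icc a b, |f k x| ≤ C)
    (hf : ∀ k, ∀ x ∈ Set.Icc a b, ∀ y ∈ Set.Icc a b, |f k x - f k y| ≤ |W x - W y|) :
    ∃ (φ : ℕ → ℕ) (g : ℝ → ℝ), StrictMono φ ∧ Continuous g ∧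
      TendstoUniformlyOn (fun k => f (φ k)) g atTop (Set.Icc a b) := by
  have hmod : ∀ x : Set.Icc a b, Tendsto (fun y : Set.Icc a b => |W x - W y|) (𝓝 x) (𝓝 0) :=
    fun x => by
      have : Continuous fun y : Set.Icc a b => |W x - W y| := by fun_prop
      simpa using this.tendsto x
  have hcont : ∀ k, Continuous fun x : Set.Icc a b => f k x := fun k =>
    continuous_iff_continuousAt.2 fun x => by
      rw [ContinuousAt, tendsto_iff_dist_tendsto_zero]
      refine squeeze_zero (fun _ => dist_nonneg) (fun y => ?_) (hmod x)
      rw [dist_comm, Real.dist_eq]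
      exact hf k x x.2 y y.2
  set fB : ℕ → BoundedContinuousFunction (Set.Icc a b) ℝ := fun k =>
    BoundedContinuousFunction.mkOfCompact ⟨fun x => f k x, hcont k⟩ with hfB
  have hcpt := BoundedContinuousFunction.arzela_ascoli (Set.Icc (-C) C) isCompact_Icc
    (Set.range fB) (by
      rintro _ x ⟨k, rfl⟩
      exact abs_le.1 (hC k x x.2)) (fun x => by
      refine Metric.equicontinuousAt_of_continuity_modulus _ (hmod x) _ (.of_forall fun y => ?_)
      rintro ⟨_, k, rfl⟩
      exact hf k x x.2 y y.2)
  obtain ⟨g, -, φ, hφ, hg⟩ := hcpt.tendsto_subseq fun k => subset_closure (Set.mem_range_self k)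
  rw [BoundedContinuousFunction.tendsto_iff_tendstoUniformly] at hg
  refine ⟨φ, fun x => g (Set.projIcc a b hab x), hφ, g.continuous.comp continuous_projIcc, ?_⟩
  rw [Metric.tendstoUniformlyOn_iff]
  intro ε hε
  filter_upwards [Metric.tendstoUniformly_iff.1 hg ε hε] with k hk x hx
  have := hk ⟨x, hx⟩
  rwa [Set.projIcc_of_mem hab hx]

namespace IsWeight

variable {U : ℝ → ℝ}

theorem int_mul (hU : IsWeight U) {h : ℝ → ℝ} (hh : Measurable h) {C : ℝ} (hC : ∀ t, |h t| ≤ C)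
    (x y : ℝ) : IntervalIntegrable (fun t => h t * U t) volume x y :=
  ⟨(hU.int x y).1.bdd_mul hh.aestronglyMeasurable (.of_forall hC),
    (hU.int x y).2.bdd_mul hh.aestronglyMeasurable (.of_forall hC)⟩

theorem abs_integral_mul_le (hU : IsWeight U) {h : ℝ → ℝ} {C : ℝ} (hC : ∀ t, |h t| ≤ C)
    (x y : ℝ) : |∫ t in x..y, h t * U t| ≤ C * |∫ t in x..y, U t| := by
  wlog hxy : x ≤ y generalizing x y
  · have := this y x (le_of_not_ge hxy)
    rwa [intervalIntegral.integral_symm x y, abs_neg, intervalIntegral.integral_symm x y,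
      abs_neg] at this
  rw [abs_of_nonneg (hU.integral_nonneg hxy), ← intervalIntegral.integral_const_mul,
    ← Real.norm_eq_abs]
  refine intervalIntegral.norm_integral_le_of_norm_le hxy (.of_forall fun t _ => ?_)
    ((hU.int x y).const_mul C)
  rw [Real.norm_eq_abs, abs_mul, abs_of_pos (hU.pos t)]
  exact mul_le_mul_of_nonneg_right (hC t) (hU.pos t).le

end IsWeight

/-- The index of the double cell of the grid that contains `t`. -/
noncomputable def cell (a b : ℝ) (N : ℕ) (t : ℝ) : ℕ := min (N - 1) ⌊(t - a) / (b - a) * N⌋₊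

section cell

variable {a b : ℝ} {N : ℕ} {U : ℝ → ℝ}

theorem measurable_comp_cell (h : ℕ → ℝ) : Measurable fun t => h (cell a b N t) := by
  have h1 : Measurable (cell a b N) := by
    refine measurable_const.min (Nat.measurable_floor.comp ?_)
    fun_prop
  exact (measurable_from_nat (f := h)).comp h1

theorem cell_lt (hN : 0 < N) (t : ℝ) : cell a b N t < N :=
  (min_le_left _ _).trans_lt (by omega)

theorem grid_two_mul (hN : 0 < N) (i : ℕ) : grid a b N (2 * i) = a + (b - a) * (i / N) := by
  have : (N : ℝ) ≠ 0 := by positivity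
  rw [grid]; push_cast; field_simp

theorem cell_eq (hab : a < b) (hN : 0 < N) {i : ℕ} (hi : i < N) {t : ℝ}
    (ht : t ∈ Set.Ico (grid a b N (2 * i)) (grid a b N (2 * (i + 1)))) : cell a b N t = i := by
  have hba : 0 < b - a := by linarith
  have hN' : (0 : ℝ) < N := by exact_mod_cast hN
  rw [grid_two_mul hN, grid_two_mul hN] at ht
  have h1 : (i : ℝ) / N ≤ (t - a) / (b - a) := by rw [le_div_iff₀ hba]; linarith [ht.1]
  have h2 : (t - a) / (b - a) < ((i + 1 : ℕ) : ℝ) / N := by rw [div_lt_iff₀ hba]; linarith [ht.2]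
  rw [div_le_iff₀ hN'] at h1
  rw [lt_div_iff₀ hN'] at h2
  push_cast at h2
  rw [cell, (Nat.floor_eq_iff ((Nat.cast_nonneg i).trans h1)).2 ⟨h1, h2⟩]
  exact min_eq_right (by omega)

theorem exists_mem_cell (hab : a < b) (hN : 0 < N) {t : ℝ} (ht : t ∈ Set.Icc a b) :
    t ∈ Set.Icc (grid a b N (2 * cell a b N t)) (grid a b N (2 * (cell a b N t + 1))) := by
  have hba : 0 < b - a := by linarith
  have hN' : (0 : ℝ) < N := by exact_mod_cast hN
  rcases ht.2.eq_or_lt with rfl | htb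
  · have : cell a t N t = N - 1 := by
      rw [cell, div_self hba.ne', one_mul, Nat.floor_natCast]
      exact min_eq_left (by omega)
    rw [this, show 2 * (N - 1 + 1) = 2 * N by omega, grid_last hN]
    exact ⟨(grid_mem hab hN (by omega)).2, le_rfl⟩
  · have h0 : 0 ≤ (t - a) / (b - a) * N :=
      mul_nonneg (div_nonneg (by linarith [ht.1]) hba.le) hN'.le
    have hlt : (t - a) / (b - a) * N < N := by
      have : (t - a) / (b - a) < 1 := by rw [div_lt_one hba]; linarith
      nlinarith
    have hfl : ⌊(t - a) / (b - a) * N⌋₊ < N := (Nat.floor_lt h0).2 hlt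
    have hc : cell a b N t = ⌊(t - a) / (b - a) * N⌋₊ := min_eq_right (by omega)
    rw [hc, grid_two_mul hN, grid_two_mul hN]
    have e : t = a + (b - a) * ((t - a) / (b - a) * N / N) := by field_simp; ring
    have h1 := Nat.floor_le h0
    have h2 := Nat.lt_floor_add_one ((t - a) / (b - a) * N)
    have h3 := mul_le_mul_of_nonneg_left (div_le_div_of_nonneg_right h1 hN'.le) hba.le
    have h4 := mul_le_mul_of_nonneg_left (div_le_div_of_nonneg_right h2.le hN'.le) hba.le
    push_cast
    constructor <;> linarith

theorem abs_comp_cell_le (hN : 0 < N) (h : ℕ → ℝ) (t : ℝ) :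
    |h (cell a b N t)| ≤ ∑ k ∈ Finset.range N, |h k| :=
  Finset.single_le_sum (f := fun k => |h k|) (fun k _ => abs_nonneg (h k))
    (Finset.mem_range.2 (cell_lt hN t))

theorem integral_comp_cell_succ (hab : a < b) (hN : 0 < N) (hU : IsWeight U) (h : ℕ → ℝ) {i : ℕ}
    (hi : i < N) : ∫ t in a..grid a b N (2 * (i + 1)), h (cell a b N t) * U t =
      (∫ t in a..grid a b N (2 * i), h (cell a b N t) * U t) +
        h i * ∫ t in grid a b N (2 * i)..grid a b N (2 * (i + 1)), U t := by
  have hint := hU.int_mul (measurable_comp_cell h) (abs_comp_cell_le (a := a) (b := b) hN h)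
  rw [← intervalIntegral.integral_add_adjacent_intervals (hint _ _) (hint _ _),
    ← intervalIntegral.integral_const_mul]
  congr 1
  refine intervalIntegral.integral_congr_Ioo_of_le (grid_mono hab (by omega)) fun t ht => ?_
  simp only [cell_eq hab hN hi (Set.Ioo_subset_Ico_self ht)]

end cell

section interpolation

variable {P Q a b : ℝ} {U V : ℝ → ℝ} {N : ℕ} {F G : ℕ → ℝ} {c₁ c₂ : ℝ}

/-- At cell ends the scheme is an exact integral equation with a piecewise constant integrand: `G`
is frozen at its value on entering the cell. The companion for `G` freezes `F` after the kick of the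
same cell. -/
theorem IsKick.fst_eq_integral (hab : a < b) (hN : 0 < N) (hU : IsWeight U) (h : IsKick P Q
    (fun j => c₁ * massEven U a b N j) (fun j => c₂ * massOdd V a b N j) F G) (h0 : F 0 = 0)
    {i : ℕ} (hi : i ≤ N) : F (2 * i) =
      c₁ * ∫ t in a..grid a b N (2 * i), signedPow P (G (2 * cell a b N t)) * U t := by
  induction i with
  | zero => simp [h0, grid_zero]
  | succ i ih =>
    rw [integral_comp_cell_succ hab hN hU (fun k => signedPow P (G (2 * k))) (by omega), mul_add c₁,
      ← ih (by omega), show 2 * (i + 1) = 2 * i + 1 + 1 by ring, h.fst_succ, h.fst_succ,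
      massEven_odd, massEven, if_pos (even_two_mul i)]
    ring

theorem IsKick.snd_eq_integral (hab : a < b) (hN : 0 < N) (hV : IsWeight V) (h : IsKick P Q
    (fun j => c₁ * massEven U a b N j) (fun j => c₂ * massOdd V a b N j) F G)
    {i : ℕ} (hi : i ≤ N) : G (2 * i) =
      G 0 - c₂ * ∫ t in a..grid a b N (2 * i), signedPow Q (F (2 * cell a b N t + 1)) * V t := by
  induction i with
  | zero => simp [grid_zero]
  | succ i ih =>
    rw [integral_comp_cell_succ hab hN hV (fun k => signedPow Q (F (2 * k + 1))) (by omega),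
      mul_add c₂, ← sub_sub, ← ih (by omega), show 2 * (i + 1) = 2 * i + 1 + 1 by ring, h.snd_succ,
      h.snd_succ, massOdd_even, massOdd, if_neg (by simp), Nat.add_sub_cancel]
    ring

theorem IsKick.fst_eq_fst (h : IsKick P Q
    (fun j => c₁ * massEven U a b N j) (fun j => c₂ * massOdd V a b N j) F G) (j : ℕ) :
    F j = F (2 * ((j + 1) / 2)) := by
  rcases Nat.even_or_odd' j with ⟨i, rfl | rfl⟩
  · rw [show (2 * i + 1) / 2 = i by omega]
  · rw [show 2 * ((2 * i + 1 + 1) / 2) = 2 * i + 1 + 1 by omega, h.fst_succ (2 * i + 1), massEven_odd]; simp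

theorem IsKick.snd_eq_snd (h : IsKick P Q
    (fun j => c₁ * massEven U a b N j) (fun j => c₂ * massOdd V a b N j) F G) (j : ℕ) :
    G j = G (2 * (j / 2)) := by
  rcases Nat.even_or_odd' j with ⟨i, rfl | rfl⟩
  · rw [show 2 * i / 2 = i by omega]
  · rw [show 2 * ((2 * i + 1) / 2) = 2 * i by omega, h.snd_succ, massOdd_even]; simp

end interpolation

end HardySystem

/-! ### The limit of the discrete solutions. -/

namespace HardySystem

open Filter Topology

/-- A solution `(f, g)` of the integral system on `[a, b]` that runs through the quadrants
`0, 1, …, 2n`, with switching points `t`. -/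
structure IsArcSolution (P Q a b : ℝ) (U V : ℝ → ℝ) (n : ℕ) (c₁ c₂ : ℝ) (f g : ℝ → ℝ)
    (t : ℕ → ℝ) : Prop where
  fst_nonneg : 0 ≤ c₁
  snd_nonneg : 0 ≤ c₂
  cont_fst : Continuous f
  cont_snd : Continuous g
  fst_eq : ∀ x ∈ Set.Icc a b, f x = c₁ * ∫ s in a..x, signedPow P (g s) * U s
  snd_eq : ∀ x ∈ Set.Icc a b, g x = g a - c₂ * ∫ s in a..x, signedPow Q (f s) * V s
  start : t 0 = a
  last : t (2 * n + 1) = b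
  le_succ : ∀ k ≤ 2 * n, t k ≤ t (k + 1)
  mem : ∀ k ≤ 2 * n, ∀ x ∈ Set.Ioo (t k) (t (k + 1)), InQuadrant k (f x) (g x)
  fst_zero : ∀ i ≤ n, f (t (2 * i)) = 0
  snd_zero : ∀ i ≤ n, g (t (2 * i + 1)) = 0
  exists_ne : ∃ x ∈ Set.Icc a b, |f x| = 1 ∧ |g x| = 1

/-- A limiting switching point lies in two consecutive closed quadrants, hence on their common axis.
-/
theorem eq_zero_of_alternating {k : ℕ} {x : ℝ} (h1 : 0 ≤ (-1) ^ k * x)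
    (h2 : 0 ≤ (-1) ^ (k + 1) * x) : x = 0 := by
  rw [pow_succ] at h2
  rcases neg_one_pow_eq_or ℝ k with h | h <;> rw [h] at h1 h2 <;> linarith

theorem tendsto_grid_of_near {a b x : ℝ} {N i j : ℕ → ℕ} (hab : a < b)
    (hN : Tendsto (fun ν => (N ν : ℝ)) atTop atTop)
    (hij : ∀ ν, i ν ≤ j ν + 2 ∧ j ν ≤ i ν + 2)
    (h : Tendsto (fun ν => grid a b (N ν) (j ν)) atTop (𝓝 x)) :
    Tendsto (fun ν => grid a b (N ν) (i ν)) atTop (𝓝 x) := by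
  have h0 : Tendsto (fun ν => grid a b (N ν) (i ν) - grid a b (N ν) (j ν)) atTop (𝓝 0) := by
    have hz : Tendsto (fun ν => (b - a) / (N ν : ℝ)) atTop (𝓝 0) := hN.const_div_atTop _
    refine squeeze_zero_norm (fun ν => ?_) hz
    have h1 : (i ν : ℝ) ≤ j ν + 2 := by exact_mod_cast (hij ν).1
    have h2 : (j ν : ℝ) ≤ i ν + 2 := by exact_mod_cast (hij ν).2
    rw [grid_sub, Real.norm_eq_abs, abs_mul, abs_div, abs_of_pos (show 0 < b - a by linarith),
      abs_of_nonneg (show (0 : ℝ) ≤ 2 * N ν by positivity), div_eq_mul_inv (b - a),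
      div_eq_mul_inv, mul_inv]
    have h3 : |(i ν : ℝ) - j ν| ≤ 2 := abs_le.2 ⟨by linarith, by linarith⟩
    have h4 : (0 : ℝ) ≤ (N ν : ℝ)⁻¹ := by positivity
    refine mul_le_mul_of_nonneg_left ?_ (by linarith)
    nlinarith
  simpa using h0.add h

theorem tendsto_grid_cell {a b x : ℝ} {N : ℕ → ℕ} (hab : a < b) (hN0 : ∀ ν, 0 < N ν)
    (hN : Tendsto (fun ν => (N ν : ℝ)) atTop atTop) (hx : x ∈ Set.Icc a b) :
    Tendsto (fun ν => grid a b (N ν) (2 * cell a b (N ν) x)) atTop (𝓝 x) := by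
  have hz : Tendsto (fun ν => x - (b - a) / (N ν : ℝ)) atTop (𝓝 x) := by
    simpa using (tendsto_const_nhds (x := x)).sub (hN.const_div_atTop (b - a))
  refine tendsto_of_tendsto_of_tendsto_of_le_of_le hz tendsto_const_nhds (fun ν => ?_) fun ν =>
    (exists_mem_cell hab (hN0 ν) hx).1
  have h1 := (exists_mem_cell hab (hN0 ν) hx).2
  rw [grid_two_mul (hN0 ν)] at h1
  simp only [grid_two_mul (hN0 ν)]
  push_cast at h1
  rw [add_div, mul_add, mul_one_div] at h1
  linarith

theorem tendsto_integral_comp {P C a x : ℝ} (hP : 1 < P) (hax : a ≤ x)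
    {U : ℝ → ℝ} (hU : IsWeight U) {w : ℕ → ℝ → ℝ} {g : ℝ → ℝ} (hw : ∀ ν, Measurable (w ν))
    (hC : ∀ ν s, |w ν s| ≤ C)
    (hlim : ∀ s ∈ Set.Icc a x, Tendsto (fun ν => w ν s) atTop (𝓝 (g s))) :
    Tendsto (fun ν => ∫ s in a..x, signedPow P (w ν s) * U s) atTop
      (𝓝 (∫ s in a..x, signedPow P (g s) * U s)) := by
  have hcont := continuous_signedPow hP
  have hb : ∀ ν s, |signedPow P (w ν s)| ≤ signedPow P C := fun ν s => by
    rw [← signedPow_abs hP]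
    exact signedPow_le_signedPow hP (abs_nonneg _) (hC ν s)
  refine intervalIntegral.tendsto_integral_filter_of_dominated_convergence
    (fun s => signedPow P C * U s) (.of_forall fun ν => ?_) (.of_forall fun ν =>
    .of_forall fun s _ => ?_) ((hU.int a x).const_mul _) (.of_forall fun s hs => ?_)
  · have := (hU.int_mul (hcont.measurable.comp (hw ν)) (hb ν) a x).def'
    exact this.aestronglyMeasurable
  · rw [Real.norm_eq_abs, abs_mul, abs_of_pos (hU.pos s)]
    exact mul_le_mul_of_nonneg_right (hb ν s) (hU.pos s).le
  · rw [Set.uIoc_of_le hax] at hs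
    exact ((hcont.tendsto _).comp (hlim s (Set.Ioc_subset_Icc_self hs))).mul_const _

theorem exists_isArcSolution {P Q : ℝ} (hP : 1 < P) (hQ : 1 < Q) {a b : ℝ} (hab : a < b)
    {U V : ℝ → ℝ} (hU : IsWeight U) (hV : IsWeight V) (n : ℕ) :
    ∃ (c₁ c₂ : ℝ) (f g : ℝ → ℝ) (t : ℕ → ℝ), IsArcSolution P Q a b U V n c₁ c₂ f g t := by
  obtain ⟨N₀, C, hN₀, hex⟩ := exists_discrete_winding hP hQ hab hU hV n
  choose c₁ hc₁ c₂ hc₂ F G κ M hk hw hM hFM hGM hb using fun ν : ℕ =>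
    hex (N₀ + ν) (Nat.le_add_right N₀ ν)
  set N : ℕ → ℕ := fun ν => N₀ + ν with hNdef
  have hN0 : ∀ ν, 0 < N ν := fun ν => by simp only [hNdef]; omega
  have hNt : Tendsto (fun ν => (N ν : ℝ)) atTop atTop :=
    tendsto_natCast_atTop_atTop.comp (tendsto_atTop_mono (fun ν => Nat.le_add_left ν N₀) tendsto_id)
  have hC0 : 0 ≤ C := (hc₁ 0).1.trans (hc₁ 0).2
  have hG' : ∀ ν s, |G ν (2 * cell a b (N ν) s)| ≤ C := fun ν s =>
    (hb ν _ (by have := cell_lt (a := a) (b := b) (hN0 ν) s; simp only [hNdef] at this ⊢; omega)).2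
  have hF' : ∀ ν s, |F ν (2 * cell a b (N ν) s + 1)| ≤ C := fun ν s =>
    (hb ν _ (by have := cell_lt (a := a) (b := b) (hN0 ν) s; simp only [hNdef] at this ⊢; omega)).1
  have hGm : ∀ ν, Measurable fun s => G ν (2 * cell a b (N ν) s) := fun ν =>
    measurable_comp_cell (fun k => G ν (2 * k))
  have hFm : ∀ ν, Measurable fun s => F ν (2 * cell a b (N ν) s + 1) := fun ν =>
    measurable_comp_cell (fun k => F ν (2 * k + 1))
  -- a common modulus of continuity for indefinite integrals
  have modulus : ∀ {P : ℝ} {U : ℝ → ℝ} {c : ℕ → ℝ} {w : ℕ → ℝ → ℝ}, 1 < P → IsWeight U →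
      (∀ ν, c ν ∈ Set.Icc 0 C) → (∀ ν, Measurable (w ν)) → (∀ ν s, |w ν s| ≤ C) →
      ∀ ν x y, |c ν * (∫ s in a..x, signedPow P (w ν s) * U s) -
        c ν * ∫ s in a..y, signedPow P (w ν s) * U s| ≤
        |C * signedPow P C * (∫ s in a..x, U s) - C * signedPow P C * ∫ s in a..y, U s| := by
    intro P U c w hP hU hc hwm hwC ν x y
    have hb : ∀ s, |signedPow P (w ν s)| ≤ signedPow P C := fun s => by
      rw [← signedPow_abs hP]
      exact signedPow_le_signedPow hP (abs_nonneg _) (hwC ν s)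
    have hint : ∀ x y, IntervalIntegrable (fun s => signedPow P (w ν s) * U s) volume x y :=
      hU.int_mul ((continuous_signedPow hP).measurable.comp (hwm ν)) hb
    have hPC := signedPow_nonneg (P := P) hC0
    rw [← mul_sub, ← mul_sub, intervalIntegral.integral_interval_sub_left (hint _ _) (hint _ _),
      intervalIntegral.integral_interval_sub_left (hU.int _ _) (hU.int _ _), abs_mul, abs_mul,
      abs_of_nonneg (hc ν).1, abs_of_nonneg (mul_nonneg hC0 hPC), mul_assoc]
    exact mul_le_mul (hc ν).2 (hU.abs_integral_mul_le hb y x) (abs_nonneg _) hC0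
  have modF := modulus hP hU hc₁ hGm hG'
  have modG := modulus hQ hV hc₂ hFm hF'
  set fN : ℕ → ℝ → ℝ := fun ν x =>
    c₁ ν * ∫ s in a..x, signedPow P (G ν (2 * cell a b (N ν) s)) * U s with hfN
  set gN : ℕ → ℝ → ℝ := fun ν x =>
    G ν 0 - c₂ ν * ∫ s in a..x, signedPow Q (F ν (2 * cell a b (N ν) s + 1)) * V s with hgN
  have hW : ∀ {U : ℝ → ℝ} (P : ℝ), IsWeight U →
      Continuous fun x => C * signedPow P C * ∫ s in a..x, U s := fun P hU =>
    continuous_const.mul (intervalIntegral.continuous_primitive hU.int a)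
  have hWb : ∀ {U : ℝ → ℝ} (P : ℝ), IsWeight U → ∀ x ∈ Set.Icc a b,
      |C * signedPow P C * (∫ s in a..x, U s) - C * signedPow P C * ∫ s in a..a, U s| ≤
        C * signedPow P C * ∫ s in a..b, U s := fun P hU x hx => by
    have hPC := mul_nonneg hC0 (signedPow_nonneg (P := P) hC0)
    rw [intervalIntegral.integral_same, mul_zero, sub_zero,
      abs_of_nonneg (mul_nonneg hPC (hU.integral_nonneg hx.1))]
    exact mul_le_mul_of_nonneg_left (hU.integral_mono le_rfl hx.2) hPC
  obtain ⟨φ₁, f, hφ₁, hfc, hfu⟩ := exists_tendstoUniformlyOn_subseq hab.le (f := fN) (hW P hU)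
    (C := C * signedPow P C * ∫ s in a..b, U s)
    (fun ν x hx => by
      have := (modF ν x a).trans (hWb P hU x hx)
      rwa [intervalIntegral.integral_same, mul_zero, sub_zero] at this)
    fun ν x _ y _ => modF ν x y
  obtain ⟨φ₂, g, hφ₂, hgc, hgu⟩ := exists_tendstoUniformlyOn_subseq hab.le
    (f := fun ν => gN (φ₁ ν)) (hW Q hV) (C := C + C * signedPow Q C * ∫ s in a..b, V s)
    (fun ν x hx => by
      have := (modG (φ₁ ν) x a).trans (hWb Q hV x hx)
      rw [intervalIntegral.integral_same, mul_zero, sub_zero] at this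
      exact (abs_sub _ _).trans (add_le_add (hb _ 0 (Nat.zero_le _)).2 this))
    fun ν x _ y _ => by
      have := modG (φ₁ ν) x y
      simp only [hgN]
      rwa [sub_sub_sub_cancel_left, abs_sub_comm]
  -- Coefficients, switching points and normalisation point are extracted together from one compact
  -- product. Indices `k > 2n + 1` have an uncontrolled `hit`, so it is clipped to stay on the grid.
  set Z : ℕ → (ℝ × ℝ) × (ℕ → ℝ) × ℝ := fun ν => ((c₁ ν, c₂ ν),
    (fun k => grid a b (N ν) (min (hit (κ ν) k) (2 * N ν))), grid a b (N ν) (M ν)) with hZ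
  have hZc : IsCompact ((Set.Icc 0 C ×ˢ Set.Icc 0 C) ×ˢ
      ((Set.univ.pi fun _ : ℕ => Set.Icc a b) ×ˢ Set.Icc a b)) :=
    (isCompact_Icc.prod isCompact_Icc).prod
      ((isCompact_univ_pi fun _ => isCompact_Icc).prod isCompact_Icc)
  obtain ⟨⟨⟨d₁, d₂⟩, t, x₀⟩, hmem, φ₃, hφ₃, hlim⟩ := hZc.tendsto_subseq (x := fun ν => Z (φ₁ (φ₂ ν)))
    fun ν => ⟨⟨hc₁ _, hc₂ _⟩, fun k _ => grid_mem hab (hN0 _) (min_le_right _ _),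
      grid_mem hab (hN0 _) (hM _)⟩
  set ψ : ℕ → ℕ := fun ν => φ₁ (φ₂ (φ₃ ν)) with hψ
  have hψt : Tendsto ψ atTop atTop :=
    hφ₁.tendsto_atTop.comp (hφ₂.tendsto_atTop.comp hφ₃.tendsto_atTop)
  have hNψ : Tendsto (fun ν => (N (ψ ν) : ℝ)) atTop atTop := hNt.comp hψt
  have hN0ψ : ∀ ν, 0 < N (ψ ν) := fun ν => hN0 _
  have hfψ : TendstoUniformlyOn (fun ν => fN (ψ ν)) f atTop (Set.Icc a b) := fun u hu =>
    (hφ₂.tendsto_atTop.comp hφ₃.tendsto_atTop).eventually (hfu u hu)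
  have hgψ : TendstoUniformlyOn (fun ν => gN (ψ ν)) g atTop (Set.Icc a b) := fun u hu =>
    hφ₃.tendsto_atTop.eventually (hgu u hu)
  rw [nhds_prod_eq, nhds_prod_eq, nhds_prod_eq, tendsto_prod_iff', tendsto_prod_iff',
    tendsto_prod_iff'] at hlim
  obtain ⟨⟨hd₁, hd₂⟩, ht, hx₀⟩ := hlim
  rw [tendsto_pi_nhds] at ht
  have hlimF : ∀ (j : ℕ → ℕ) (x : ℝ), (∀ ν, j ν ≤ 2 * N (ψ ν)) →
      Tendsto (fun ν => grid a b (N (ψ ν)) (j ν)) atTop (𝓝 x) →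
      Tendsto (fun ν => F (ψ ν) (j ν)) atTop (𝓝 (f x)) := fun j x hj hx => by
    have h1 : Tendsto (fun ν => grid a b (N (ψ ν)) (2 * ((j ν + 1) / 2))) atTop
        (𝓝[Set.Icc a b] x) :=
      tendsto_nhdsWithin_iff.2 ⟨tendsto_grid_of_near hab hNψ (fun ν => by omega) hx,
        .of_forall fun ν => grid_mem hab (hN0ψ ν) (by have := hj ν; omega)⟩
    refine (hfψ.tendsto_comp hfc.continuousWithinAt h1).congr fun ν => ?_
    rw [(hk (ψ ν)).fst_eq_fst (j ν), (hk (ψ ν)).fst_eq_integral hab (hN0ψ ν) hU (hw (ψ ν)).fst_zero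
      (i := (j ν + 1) / 2) (by have := hj ν; omega)]
  have hlimG : ∀ (j : ℕ → ℕ) (x : ℝ), (∀ ν, j ν ≤ 2 * N (ψ ν)) →
      Tendsto (fun ν => grid a b (N (ψ ν)) (j ν)) atTop (𝓝 x) →
      Tendsto (fun ν => G (ψ ν) (j ν)) atTop (𝓝 (g x)) := fun j x hj hx => by
    have h1 : Tendsto (fun ν => grid a b (N (ψ ν)) (2 * (j ν / 2))) atTop
        (𝓝[Set.Icc a b] x) :=
      tendsto_nhdsWithin_iff.2 ⟨tendsto_grid_of_near hab hNψ (fun ν => by omega) hx,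
        .of_forall fun ν => grid_mem hab (hN0ψ ν) (by have := hj ν; omega)⟩
    refine (hgψ.tendsto_comp hgc.continuousWithinAt h1).congr fun ν => ?_
    rw [(hk (ψ ν)).snd_eq_snd (j ν), (hk (ψ ν)).snd_eq_integral hab (hN0ψ ν) hV
      (i := j ν / 2) (by have := hj ν; omega)]
  have hcell : ∀ s ∈ Set.Icc a b,
      Tendsto (fun ν => grid a b (N (ψ ν)) (2 * cell a b (N (ψ ν)) s)) atTop (𝓝 s) :=
    fun s hs => tendsto_grid_cell hab hN0ψ hNψ hs
  have hcell_lt : ∀ ν s, 2 * cell a b (N (ψ ν)) s + 1 ≤ 2 * N (ψ ν) := fun ν s => by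
    have := cell_lt (a := a) (b := b) (hN0ψ ν) s
    omega
  have hsub : ∀ x ∈ Set.Icc a b, ∀ s ∈ Set.Icc a x, s ∈ Set.Icc a b :=
    fun x hx s hs => ⟨hs.1, hs.2.trans hx.2⟩
  have hfeq : ∀ x ∈ Set.Icc a b, f x = d₁ * ∫ s in a..x, signedPow P (g s) * U s := fun x hx =>
    tendsto_nhds_unique (hfψ.tendsto_at hx) (hd₁.mul (tendsto_integral_comp hP hx.1 hU
      (fun ν => hGm (ψ ν)) (fun ν => hG' (ψ ν)) fun s hs => hlimG _ s
        (fun ν => by have := hcell_lt ν s; omega) (hcell s (hsub x hx s hs))))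
  have hgeq : ∀ x ∈ Set.Icc a b, g x = g a - d₂ * ∫ s in a..x, signedPow Q (f s) * V s :=
    fun x hx => tendsto_nhds_unique (hgψ.tendsto_at hx)
      ((hlimG (fun _ => 0) a (fun ν => Nat.zero_le _) (by simp [grid_zero])).sub
        (hd₂.mul (tendsto_integral_comp hQ hx.1 hV
      (fun ν => hFm (ψ ν)) (fun ν => hF' (ψ ν)) fun s hs => hlimF _ s
        (fun ν => hcell_lt ν s) (tendsto_grid_of_near hab hNψ (fun ν => by omega)
          (hcell s (hsub x hx s hs))))))
  have hit_le : ∀ k ≤ 2 * n + 1, ∀ ν, hit (κ (ψ ν)) k ≤ 2 * N (ψ ν) := fun k hk ν =>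
    (hw (ψ ν)).hit_le hk
  have ht' : ∀ k ≤ 2 * n + 1,
      Tendsto (fun ν => grid a b (N (ψ ν)) (hit (κ (ψ ν)) k)) atTop (𝓝 (t k)) := fun k hk =>
    (ht k).congr fun ν => by
      show grid a b (N (ψ ν)) (min (hit (κ (ψ ν)) k) (2 * N (ψ ν))) = _
      rw [min_eq_left (hit_le k hk ν)]
  -- The index just before a switch is still in the old quadrant and has the same limit as the
  -- switch.
  have hpred : ∀ k ≤ 2 * n, Tendsto (fun ν => grid a b (N (ψ ν)) (hit (κ (ψ ν)) (k + 1) - 1)) atTop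
      (𝓝 (t (k + 1))) := fun k hk =>
    tendsto_grid_of_near hab hNψ (fun ν => by omega) (ht' (k + 1) (by omega))
  have hquad : ∀ (k : ℕ) (x : ℝ) (j : ℕ → ℕ), (∀ ν, j ν ≤ 2 * N (ψ ν)) →
      (∀ᶠ ν in atTop, κ (ψ ν) (j ν) = k) →
      Tendsto (fun ν => grid a b (N (ψ ν)) (j ν)) atTop (𝓝 x) → InQuadrant k (f x) (g x) := by
    intro k x j hj hκ hx
    refine ⟨ge_of_tendsto ((hlimF j x hj hx).const_mul _) (hκ.mono fun ν hν => ?_),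
      ge_of_tendsto ((hlimG j x hj hx).const_mul _) (hκ.mono fun ν hν => ?_)⟩
    · exact hν ▸ ((hw (ψ ν)).mem (j ν)).1
    · exact hν ▸ ((hw (ψ ν)).mem (j ν)).2
  have hswitch : ∀ k ≤ 2 * n, InQuadrant k (f (t (k + 1))) (g (t (k + 1))) ∧
      InQuadrant (k + 1) (f (t (k + 1))) (g (t (k + 1))) := fun k hk =>
    ⟨hquad k _ _ (fun ν => by have := hit_le (k + 1) (by omega) ν; omega)
      (.of_forall fun ν => ((hw (ψ ν)).apply_pred_hit hk).1) (hpred k hk),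
    hquad (k + 1) _ _ (hit_le (k + 1) (by omega))
      (.of_forall fun ν => ((hw (ψ ν)).apply_pred_hit hk).2) (ht' (k + 1) (by omega))⟩
  have ht0 : t 0 = a := by
    refine tendsto_nhds_unique (ht' 0 (by omega)) ?_
    simp [IsWinding.hit_zero, grid_zero]
  refine ⟨d₁, d₂, f, g, t, hmem.1.1.1, hmem.1.2.1, hfc, hgc, hfeq, hgeq, ht0, ?_, ?_, ?_, ?_, ?_,
    x₀, hmem.2.2, ?_, ?_⟩
  · refine tendsto_nhds_unique (ht' (2 * n + 1) le_rfl) ?_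
    refine tendsto_const_nhds.congr fun ν => ?_
    rw [(hw (ψ ν)).hit_last]
    exact (grid_last (hN0ψ ν)).symm
  · exact fun k hk => le_of_tendsto_of_tendsto' (ht' k (by omega)) (ht' (k + 1) (by omega))
      fun ν => grid_mono hab ((hw (ψ ν)).hit_le_hit (by omega) (by omega))
  · intro k hk x hx
    have hx' : x ∈ Set.Icc a b :=
      ⟨(hmem.2.1 k trivial).1.trans hx.1.le, hx.2.le.trans (hmem.2.1 (k + 1) trivial).2⟩
    refine hquad k x _ (fun ν => by have := hcell_lt ν x; omega) ?_ (hcell x hx')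
    filter_upwards [(ht' k (by omega)).eventually_lt (hcell x hx') hx.1,
      (hcell x hx').eventually_lt (ht' (k + 1) (by omega)) hx.2] with ν h1 h2
    exact (hw (ψ ν)).apply_eq hk ((grid_mono hab).reflect_lt h1).le ((grid_mono hab).reflect_lt h2)
  · intro i hi
    rcases Nat.eq_zero_or_pos i with rfl | hi0
    · rw [mul_zero, ht0, hfeq a ⟨le_rfl, hab.le⟩]; simp
    · obtain ⟨h1, h2⟩ := hswitch (2 * i - 1) (by omega)
      rw [show 2 * i - 1 + 1 = 2 * i by omega] at h1 h2
      refine eq_zero_of_alternating (k := i - 1) ?_ ?_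
      · have := h1.1
        rwa [show (2 * i - 1) / 2 = i - 1 by omega] at this
      · have := h2.1
        rwa [show 2 * i / 2 = i - 1 + 1 by omega] at this
  · intro i hi
    obtain ⟨h1, h2⟩ := hswitch (2 * i) (by omega)
    refine eq_zero_of_alternating (k := i) ?_ ?_
    · have := h1.2
      rwa [show (2 * i + 1) / 2 = i by omega] at this
    · have := h2.2
      rwa [show (2 * i + 1 + 1) / 2 = i + 1 by omega] at this
  · exact tendsto_nhds_unique ((hlimF _ x₀ (fun ν => hM (ψ ν)) hx₀).abs)
      (tendsto_const_nhds.congr fun ν => (hFM (ψ ν)).symm)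
  · exact tendsto_nhds_unique ((hlimG _ x₀ (fun ν => hM (ψ ν)) hx₀).abs)
      (tendsto_const_nhds.congr fun ν => (hGM (ψ ν)).symm)

end HardySystem

namespace HardySystem

open Filter Topology

/-! ### Zeros of the limit solution -/

/-- By continuity `g` keeps its weak sign on the closed interval and is nonzero on a nonempty open
subset, where the integrand has a strict sign. -/
theorem integral_signedPow_ne_zero {P x y z : ℝ} (hP : 1 < P) {U g : ℝ → ℝ} (hU : IsWeight U)
    (hg : Continuous g) (hxy : x < y) {k : ℕ} (hs : ∀ w ∈ Set.Ioo x y, 0 ≤ (-1) ^ k * g w)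
    (hz : z ∈ Set.Icc x y) (hgz : g z ≠ 0) : ∫ s in x..y, signedPow P (g s) * U s ≠ 0 := by
  have hc := continuous_signedPow hP
  have hint : IntervalIntegrable (fun s => (-1) ^ k * (signedPow P (g s) * U s)) volume x y :=
    ((hU.int x y).continuousOn_mul (hc.comp hg).continuousOn).const_mul _
  have hclos : ∀ w ∈ Set.Icc x y, 0 ≤ (-1) ^ k * g w := fun w hw => by
    rw [← closure_Ioo hxy.ne] at hw
    have hcl : IsClosed {w | 0 ≤ (-1) ^ k * g w} :=
      isClosed_le continuous_const (continuous_const.mul hg)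
    exact closure_minimal (fun w hw => hs w hw) hcl hw
  have hnn : ∀ w ∈ Set.Ioc x y, 0 ≤ (-1) ^ k * (signedPow P (g w) * U w) := fun w hw => by
    have := signedPow_nonneg (P := P) (hclos w (Set.Ioc_subset_Icc_self hw))
    rw [signedPow_mul, signedPow_neg_one_pow] at this
    have := mul_nonneg this (hU.pos w).le
    linarith
  have hpos : 0 < ∫ s in x..y, (-1) ^ k * (signedPow P (g s) * U s) := by
    rw [intervalIntegral.integral_pos_iff_support_of_nonneg_ae' ?_ hint]
    · refine ⟨hxy, ?_⟩
      have hopen : IsOpen ({w | g w ≠ 0} ∩ Set.Ioo x y) :=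
        (isOpen_ne.preimage hg).inter isOpen_Ioo
      have hne : ({w | g w ≠ 0} ∩ Set.Ioo x y).Nonempty := by
        rw [← closure_Ioo hxy.ne] at hz
        exact mem_closure_iff.1 hz _ (isOpen_ne.preimage hg) hgz
      refine (hopen.measure_pos volume hne).trans_le (measure_mono fun w hw => ⟨?_, hw.2.1, hw.2.2.le⟩)
      exact mul_ne_zero (pow_ne_zero _ (by norm_num))
        (mul_ne_zero (signedPow_ne_zero hw.1) (hU.pos w).ne')
    · rw [Set.uIoc_of_le hxy.le]
      exact (ae_restrict_iff' measurableSet_Ioc).2 (.of_forall hnn)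
  intro h0
  rw [intervalIntegral.integral_const_mul, h0, mul_zero] at hpos
  exact lt_irrefl _ hpos

namespace IsArcSolution

variable {P Q a b : ℝ} {U V : ℝ → ℝ} {n : ℕ} {c₁ c₂ : ℝ} {f g : ℝ → ℝ} {t : ℕ → ℝ}

theorem snd_last (h : IsArcSolution P Q a b U V n c₁ c₂ f g t) : g b = 0 :=
  h.last ▸ h.snd_zero n le_rfl

/-- `c₁ = 0` would make `f` vanish identically, against `exists_ne`. -/
theorem fst_coeff_ne_zero (h : IsArcSolution P Q a b U V n c₁ c₂ f g t) : c₁ ≠ 0 := by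
  rintro rfl
  obtain ⟨x, hx, h1, -⟩ := h.exists_ne
  rw [h.fst_eq x hx] at h1
  simp at h1

theorem snd_coeff_ne_zero (h : IsArcSolution P Q a b U V n c₁ c₂ f g t) : c₂ ≠ 0 := by
  rintro rfl
  obtain ⟨x, hx, -, h1⟩ := h.exists_ne
  have h2 := h.snd_eq b ⟨hx.1.trans hx.2, le_rfl⟩
  rw [h.snd_last, zero_mul, sub_zero] at h2
  rw [h.snd_eq x hx, ← h2] at h1
  simp at h1

theorem int_fst (h : IsArcSolution P Q a b U V n c₁ c₂ f g t) (hP : 1 < P) (hU : IsWeight U)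
    (x y : ℝ) : IntervalIntegrable (fun s => signedPow P (g s) * U s) volume x y :=
  (hU.int x y).continuousOn_mul ((continuous_signedPow hP).comp h.cont_snd).continuousOn

theorem int_snd (h : IsArcSolution P Q a b U V n c₁ c₂ f g t) (hQ : 1 < Q) (hV : IsWeight V)
    (x y : ℝ) : IntervalIntegrable (fun s => signedPow Q (f s) * V s) volume x y :=
  (hV.int x y).continuousOn_mul ((continuous_signedPow hQ).comp h.cont_fst).continuousOn

theorem fst_sub (h : IsArcSolution P Q a b U V n c₁ c₂ f g t) (hP : 1 < P) (hU : IsWeight U)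
    {x y : ℝ} (hx : x ∈ Set.Icc a b) (hy : y ∈ Set.Icc a b) :
    f y - f x = c₁ * ∫ s in x..y, signedPow P (g s) * U s := by
  rw [h.fst_eq x hx, h.fst_eq y hy, ← mul_sub, intervalIntegral.integral_interval_sub_left
    (h.int_fst hP hU _ _) (h.int_fst hP hU _ _)]

theorem snd_sub (h : IsArcSolution P Q a b U V n c₁ c₂ f g t) (hQ : 1 < Q) (hV : IsWeight V)
    {x y : ℝ} (hx : x ∈ Set.Icc a b) (hy : y ∈ Set.Icc a b) :
    g x - g y = c₂ * ∫ s in x..y, signedPow Q (f s) * V s := by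
  rw [h.snd_eq x hx, h.snd_eq y hy, sub_sub_sub_cancel_left, ← mul_sub,
    intervalIntegral.integral_interval_sub_left (h.int_snd hQ hV _ _) (h.int_snd hQ hV _ _)]

theorem node_le (h : IsArcSolution P Q a b U V n c₁ c₂ f g t) {i j : ℕ} (hij : i ≤ j)
    (hj : j ≤ 2 * n + 1) : t i ≤ t j := by
  induction j, hij using Nat.le_induction with
  | base => exact le_rfl
  | succ j _ ih => exact (ih (by omega)).trans (h.le_succ j (by omega))

theorem node_mem (h : IsArcSolution P Q a b U V n c₁ c₂ f g t) {k : ℕ} (hk : k ≤ 2 * n + 1) :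
    t k ∈ Set.Icc a b :=
  ⟨h.start ▸ h.node_le (Nat.zero_le k) hk, h.last ▸ h.node_le hk le_rfl⟩

theorem exists_arc (h : IsArcSolution P Q a b U V n c₁ c₂ f g t) {x : ℝ}
    (hx : x ∈ Set.Icc a b) : ∃ k ≤ 2 * n, x ∈ Set.Icc (t k) (t (k + 1)) := by
  by_contra! hc
  have key : ∀ k ≤ 2 * n + 1, t k ≤ x := fun k => by
    induction k with
    | zero => intro _; rw [h.start]; exact hx.1
    | succ k ih =>
      intro hk
      by_contra! hlt
      exact hc k (by omega) ⟨ih (by omega), hlt.le⟩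
  refine hc (2 * n) le_rfl ⟨key _ (by omega), ?_⟩
  rw [h.last]; exact hx.2

theorem fst_ne (h : IsArcSolution P Q a b U V n c₁ c₂ f g t) (hP : 1 < P) (hU : IsWeight U)
    {k : ℕ} (hk : k ≤ 2 * n) {x y z : ℝ} (hxy : x < y) (hx : t k ≤ x) (hy : y ≤ t (k + 1))
    (hz : z ∈ Set.Icc x y) (hgz : g z ≠ 0) : f x ≠ f y := by
  have hkm := h.node_mem (k := k) (by omega)
  have hkm' := h.node_mem (k := k + 1) (by omega)
  intro he
  have h1 := h.fst_sub hP hU (x := x) (y := y) ⟨hkm.1.trans hx, by linarith [hkm'.2]⟩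
    ⟨by linarith [hkm.1], hy.trans hkm'.2⟩
  rw [he, sub_self] at h1
  exact mul_ne_zero h.fst_coeff_ne_zero (integral_signedPow_ne_zero hP hU h.cont_snd hxy
    (fun w hw => (h.mem k hk w ⟨hx.trans_lt hw.1, hw.2.trans_le hy⟩).2) hz hgz) h1.symm

theorem snd_ne (h : IsArcSolution P Q a b U V n c₁ c₂ f g t) (hQ : 1 < Q) (hV : IsWeight V)
    {k : ℕ} (hk : k ≤ 2 * n) {x y z : ℝ} (hxy : x < y) (hx : t k ≤ x) (hy : y ≤ t (k + 1))
    (hz : z ∈ Set.Icc x y) (hfz : f z ≠ 0) : g x ≠ g y := by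
  have hkm := h.node_mem (k := k) (by omega)
  have hkm' := h.node_mem (k := k + 1) (by omega)
  intro he
  have h1 := h.snd_sub hQ hV (x := x) (y := y) ⟨hkm.1.trans hx, by linarith [hkm'.2]⟩
    ⟨by linarith [hkm.1], hy.trans hkm'.2⟩
  rw [he, sub_self] at h1
  exact mul_ne_zero h.snd_coeff_ne_zero (integral_signedPow_ne_zero hQ hV h.cont_fst hxy
    (fun w hw => (h.mem k hk w ⟨hx.trans_lt hw.1, hw.2.trans_le hy⟩).1) hz hfz) h1.symm

/-- On each arc `f` vanishes at one end and `g` at the other. If `f` is nonzero somewhere, `g` must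
change across the arc and is nonzero at the end where `f` vanishes; symmetrically with the roles
exchanged. So one nonzero point makes both ends nonzero. This stands in for uniqueness of the
initial value problem, since `signedPow` is not Lipschitz at `0` for exponents below `2`. -/
theorem arc_nondegenerate (h : IsArcSolution P Q a b U V n c₁ c₂ f g t) (hP : 1 < P) (hQ : 1 < Q)
    (hU : IsWeight U) (hV : IsWeight V) {k : ℕ} (hk : k ≤ 2 * n) {z : ℝ}
    (hz : z ∈ Set.Icc (t k) (t (k + 1))) (hne : f z ≠ 0 ∨ g z ≠ 0) :
    t k < t (k + 1) ∧ (f (t k) ≠ 0 ∨ g (t k) ≠ 0) ∧ (f (t (k + 1)) ≠ 0 ∨ g (t (k + 1)) ≠ 0) := by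
  have hle := h.le_succ k hk
  have hl : t k ∈ Set.Icc (t k) (t (k + 1)) := ⟨le_rfl, hle⟩
  have hr : t (k + 1) ∈ Set.Icc (t k) (t (k + 1)) := ⟨hle, le_rfl⟩
  rcases Nat.even_or_odd' k with ⟨i, rfl | rfl⟩
  · have hf := h.fst_zero i (by omega)
    have hg := h.snd_zero i (by omega)
    have hlt : t (2 * i) < t (2 * i + 1) := by
      refine lt_of_le_of_ne hle fun he => ?_
      have : z = t (2 * i) := le_antisymm (he ▸ hz.2) hz.1
      subst this
      rw [← he] at hg
      exact hne.elim (fun h => h hf) fun h => h hg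
    have hF : ∀ z ∈ Set.Icc (t (2 * i)) (t (2 * i + 1)), f z ≠ 0 → g (t (2 * i)) ≠ 0 :=
      fun z hz hfz => hg ▸ h.snd_ne hQ hV hk hlt le_rfl le_rfl hz hfz
    have hG : ∀ z ∈ Set.Icc (t (2 * i)) (t (2 * i + 1)), g z ≠ 0 → f (t (2 * i + 1)) ≠ 0 :=
      fun z hz hgz => hf ▸ (h.fst_ne hP hU hk hlt le_rfl le_rfl hz hgz).symm
    refine ⟨hlt, ?_⟩
    rcases hne with hfz | hgz
    · have := hF z hz hfz
      exact ⟨Or.inr this, Or.inl (hG _ hl this)⟩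
    · have := hG z hz hgz
      exact ⟨Or.inr (hF _ hr this), Or.inl this⟩
  · have hg := h.snd_zero i (by omega)
    have hf := h.fst_zero (i + 1) (by omega)
    rw [show 2 * (i + 1) = 2 * i + 1 + 1 by ring] at hf
    have hlt : t (2 * i + 1) < t (2 * i + 1 + 1) := by
      refine lt_of_le_of_ne hle fun he => ?_
      have : z = t (2 * i + 1) := le_antisymm (he ▸ hz.2) hz.1
      subst this
      rw [← he] at hf
      exact hne.elim (fun h => h hf) fun h => h hg
    have hF : ∀ z ∈ Set.Icc (t (2 * i + 1)) (t (2 * i + 1 + 1)), f z ≠ 0 →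
        g (t (2 * i + 1 + 1)) ≠ 0 :=
      fun z hz hfz => hg ▸ (h.snd_ne hQ hV hk hlt le_rfl le_rfl hz hfz).symm
    have hG : ∀ z ∈ Set.Icc (t (2 * i + 1)) (t (2 * i + 1 + 1)), g z ≠ 0 →
        f (t (2 * i + 1)) ≠ 0 :=
      fun z hz hgz => hf ▸ h.fst_ne hP hU hk hlt le_rfl le_rfl hz hgz
    refine ⟨hlt, ?_⟩
    rcases hne with hfz | hgz
    · have := hF z hz hfz
      exact ⟨Or.inl (hG _ hr this), Or.inr this⟩
    · have := hG z hz hgz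
      exact ⟨Or.inl this, Or.inr (hF _ hl this)⟩

theorem node_ne_zero (h : IsArcSolution P Q a b U V n c₁ c₂ f g t) (hP : 1 < P) (hQ : 1 < Q)
    (hU : IsWeight U) (hV : IsWeight V) {k : ℕ} (hk : k ≤ 2 * n + 1) :
    f (t k) ≠ 0 ∨ g (t k) ≠ 0 := by
  have hiff : ∀ k ≤ 2 * n + 1, ((f (t k) ≠ 0 ∨ g (t k) ≠ 0) ↔ (f (t 0) ≠ 0 ∨ g (t 0) ≠ 0)) :=
    fun k => by
      induction k with
      | zero => exact fun _ => Iff.rfl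
      | succ k ih =>
        intro hk
        rw [← ih (by omega)]
        have hle := h.le_succ k (by omega)
        exact ⟨fun hne => (h.arc_nondegenerate hP hQ hU hV (by omega) ⟨hle, le_rfl⟩ hne).2.1,
          fun hne => (h.arc_nondegenerate hP hQ hU hV (by omega) ⟨le_rfl, hle⟩ hne).2.2⟩
  obtain ⟨x, hx, h1, -⟩ := h.exists_ne
  obtain ⟨j, hj, hxj⟩ := h.exists_arc hx
  have h2 := (h.arc_nondegenerate hP hQ hU hV hj hxj (Or.inl fun h0 => by simp [h0] at h1)).2.1
  exact (hiff k hk).2 ((hiff j (by omega)).1 h2)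

theorem node_lt (h : IsArcSolution P Q a b U V n c₁ c₂ f g t) (hP : 1 < P) (hQ : 1 < Q)
    (hU : IsWeight U) (hV : IsWeight V) {i j : ℕ} (hij : i < j) (hj : j ≤ 2 * n + 1) :
    t i < t j :=
  ((h.arc_nondegenerate hP hQ hU hV (k := i) (by omega) ⟨le_rfl, h.le_succ i (by omega)⟩
    (h.node_ne_zero hP hQ hU hV (by omega))).1).trans_le (h.node_le hij hj)

/-- Each arc has one end where `f` vanishes, and there `g` is nonzero, so `f` cannot return to the
value `0` within that arc. -/
theorem fst_eq_zero_iff (h : IsArcSolution P Q a b U V n c₁ c₂ f g t) (hP : 1 < P) (hQ : 1 < Q)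
    (hU : IsWeight U) (hV : IsWeight V) {z : ℝ} (hz : z ∈ Set.Icc a b) :
    f z = 0 ↔ ∃ i ≤ n, t (2 * i) = z := by
  refine ⟨fun hfz => ?_, fun ⟨i, hi, hiz⟩ => hiz ▸ h.fst_zero i hi⟩
  obtain ⟨k, hk, hzk⟩ := h.exists_arc hz
  rcases Nat.even_or_odd' k with ⟨i, rfl | rfl⟩
  · refine ⟨i, by omega, ?_⟩
    by_contra hne
    have hf := h.fst_zero i (by omega)
    have hg := (h.node_ne_zero hP hQ hU hV (k := 2 * i) (by omega)).resolve_left (by simp [hf])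
    exact h.fst_ne hP hU hk (lt_of_le_of_ne hzk.1 hne) le_rfl hzk.2 ⟨le_rfl, hzk.1⟩ hg
      (hf.trans hfz.symm)
  · refine ⟨i + 1, by omega, ?_⟩
    by_contra hne
    have hf := h.fst_zero (i + 1) (by omega)
    have hg := (h.node_ne_zero hP hQ hU hV (k := 2 * (i + 1)) (by omega)).resolve_left
      (by simp [hf])
    exact h.fst_ne hP hU hk (lt_of_le_of_ne hzk.2 (Ne.symm hne)) hzk.1 le_rfl ⟨hzk.2, le_rfl⟩ hg
      (hfz.trans hf.symm)

theorem zeroCount_fst (h : IsArcSolution P Q a b U V n c₁ c₂ f g t) (hP : 1 < P) (hQ : 1 < Q)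
    (hU : IsWeight U) (hV : IsWeight V) : zeroCount a b f = n := by
  have hset : {x ∈ Set.Ioo a b | f x = 0} =
      (fun i => t (2 * (i + 1))) '' (Finset.range n : Set ℕ) := by
    ext z
    simp only [Set.mem_image, Finset.coe_range, Set.mem_Iio]
    constructor
    · rintro ⟨hz, hfz⟩
      obtain ⟨i, hi, rfl⟩ := (h.fst_eq_zero_iff hP hQ hU hV (Set.Ioo_subset_Icc_self hz)).1 hfz
      rcases Nat.eq_zero_or_pos i with rfl | hi0
      · rw [mul_zero, h.start] at hz
        exact absurd hz.1 (lt_irrefl a)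
      · exact ⟨i - 1, by omega, by rw [Nat.sub_add_cancel hi0]⟩
    · rintro ⟨i, hi, rfl⟩
      refine ⟨⟨?_, ?_⟩, h.fst_zero (i + 1) (by omega)⟩
      · rw [← h.start]; exact h.node_lt hP hQ hU hV (by omega) (by omega)
      · rw [← h.last]; exact h.node_lt hP hQ hU hV (by omega) (by omega)
  have hinj : Set.InjOn (fun i => t (2 * (i + 1))) (Finset.range n : Set ℕ) := fun i hi j hj hij => by
    simp only [Finset.coe_range, Set.mem_Iio] at hi hj
    rcases lt_trichotomy i j with hlt | rfl | hlt
    · exact absurd hij (h.node_lt hP hQ hU hV (by omega) (by omega)).ne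
    · rfl
    · exact absurd hij (h.node_lt hP hQ hU hV (by omega) (by omega)).ne'
  rw [zeroCount, hset, hinj.encard_image, Set.encard_coe_eq_coe_finsetCard, Finset.card_range]

end IsArcSolution

end HardySystem

namespace HardySystem

/-! ### Spectral triples -/

/-- The value `1` outside the interval only serves to have a positive, locally integrable weight on
the whole line. -/
theorem isWeight_extend {a b r : ℝ} (hr : 0 < r) {w : ℝ → ℝ} (hpos : ∀ x ∈ Set.Icc a b, 0 < w x)
    (hw : MemLp w (ENNReal.ofReal r) (volume.restrict (Set.Icc a b))) :
    IsWeight ((Set.Icc a b).piecewise (fun x => w x ^ r) fun _ => 1) := by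
  classical
  refine ⟨fun x => ?_, fun x y => ?_⟩
  · by_cases hx : x ∈ Set.Icc a b
    · rw [Set.piecewise_eq_of_mem _ _ _ hx]; exact Real.rpow_pos_of_pos (hpos x hx) r
    · rw [Set.piecewise_eq_of_notMem _ _ _ hx]; exact one_pos
  · have h1 : IntegrableOn ((Set.Icc a b).piecewise (fun x => w x ^ r) fun _ => 1)
        (Set.Icc a b) := by
      have := hw.integrable_norm_rpow (by simpa using hr) ENNReal.ofReal_ne_top
      rw [ENNReal.toReal_ofReal hr.le] at this
      refine IntegrableOn.congr_fun this (fun s hs => ?_) measurableSet_Icc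
      simp only [Set.piecewise_eq_of_mem _ _ _ hs, Real.norm_eq_abs, abs_of_pos (hpos s hs)]
    rw [intervalIntegrable_iff]
    have h2 : IntegrableOn ((Set.Icc a b).piecewise (fun x => w x ^ r) fun _ => 1)
        (Set.uIoc x y \ Set.Icc a b) := by
      have hm : MeasurableSet (Set.uIoc x y \ Set.Icc a b) :=
        measurableSet_uIoc.diff measurableSet_Icc
      have : IntegrableOn (fun _ : ℝ => (1 : ℝ)) (Set.uIoc x y \ Set.Icc a b) :=
        (intervalIntegrable_iff.1 (intervalIntegrable_const (a := x) (b := y))).mono_set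
          Set.sdiff_subset
      refine this.congr_fun (fun s hs => ?_) hm
      rw [Set.piecewise_eq_of_notMem _ _ _ hs.2]
    refine (h1.union h2).mono_set fun s hs => ?_
    by_cases h : s ∈ Set.Icc a b
    · exact Or.inl h
    · exact Or.inr ⟨hs, h⟩

theorem signedPow_mul_self {P x : ℝ} (hP : 1 < P) (hx : 0 < x) : signedPow P x * x = x ^ P := by
  rw [signedPow_of_nonneg hP hx.le, ← Real.rpow_add_one hx.ne', sub_add_cancel]

theorem exists_mem_SPn {a b p q : ℝ} (hab : a < b) (hp : 1 < p) (hq : 1 < q) {u v : ℝ → ℝ}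
    (hu_pos : ∀ x ∈ Set.Icc a b, 0 < u x) (hv_pos : ∀ x ∈ Set.Icc a b, 0 < v x)
    (hu : MemLp u (ENNReal.ofReal p.conjExponent) (volume.restrict (Set.Icc a b)))
    (hv : MemLp v (ENNReal.ofReal q) (volume.restrict (Set.Icc a b))) (n : ℕ) :
    (SPn a b p q u v n).Nonempty := by
  classical
  have hconj := Real.HolderConjugate.conjExponent hp
  set P := p.conjExponent with hPdef
  have hP : 1 < P := hconj.symm.lt
  have hU := isWeight_extend (by linarith) hu_pos hu
  have hV := isWeight_extend (by linarith) hv_pos hv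
  set U := (Set.Icc a b).piecewise (fun x => u x ^ P) fun _ => 1 with hUdef
  set V := (Set.Icc a b).piecewise (fun x => v x ^ q) fun _ => 1 with hVdef
  have hUe : ∀ x ∈ Set.Icc a b, U x = u x ^ P := fun x hx => Set.piecewise_eq_of_mem _ _ _ hx
  have hVe : ∀ x ∈ Set.Icc a b, V x = v x ^ q := fun x hx => Set.piecewise_eq_of_mem _ _ _ hx
  obtain ⟨c₁, c₂, F, G, t, h⟩ := exists_isArcSolution hP hq hab hU hV n
  have hc₁ := h.fst_coeff_ne_zero
  have hc₂ := h.snd_coeff_ne_zero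
  have hcP := continuous_signedPow hP
  -- By conjugacy `signedPow p` inverts `signedPow P`, so `f₀` has `p`-th signed power `u G`.
  -- Moreover `f₀ u = φ_P(G) U` and `|f₀| ^ p = |G| ^ P U`, as `(P - 1) p = P`.
  set f₀ : ℝ → ℝ := fun x => signedPow P (u x * G x) with hf₀
  -- the unnormalised eigenfunction lies in `L_p` and does not vanish
  have hmeas : AEStronglyMeasurable f₀ (volume.restrict (Set.Icc a b)) :=
    hcP.comp_aestronglyMeasurable (hu.1.mul h.cont_snd.aestronglyMeasurable)
  have hp0 : ENNReal.ofReal p ≠ 0 := by simp; linarith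
  have hUint : IntegrableOn U (Set.Icc a b) := by
    rw [integrableOn_Icc_iff_integrableOn_Ioc]
    exact (hU.int a b).1
  have hmem : MemLp f₀ (ENNReal.ofReal p) (volume.restrict (Set.Icc a b)) := by
    rw [← integrable_norm_rpow_iff hmeas hp0 ENNReal.ofReal_ne_top,
      ENNReal.toReal_ofReal (by linarith)]
    have hGP : ContinuousOn (fun x => |G x| ^ P) (Set.Icc a b) :=
      (h.cont_snd.abs.rpow_const fun _ => Or.inr (by linarith)).continuousOn
    refine IntegrableOn.congr_fun (hUint.continuousOn_mul hGP isCompact_Icc) (fun x hx => ?_)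
      measurableSet_Icc
    have hux := hu_pos x hx
    simp only [hf₀]
    rw [hUe x hx, Real.norm_eq_abs, abs_signedPow hP, ← Real.rpow_mul (abs_nonneg _),
      show (P - 1) * p = P by linarith [hconj.mul_eq_add], abs_mul, abs_of_pos hux,
      Real.mul_rpow hux.le (abs_nonneg _), mul_comm]
  have hfu : ∀ x ∈ Set.Icc a b, f₀ x * u x = signedPow P (G x) * U x := fun x hx => by
    simp only [hf₀]
    rw [signedPow_mul, hUe x hx, ← signedPow_mul_self hP (hu_pos x hx)]
    ring
  have hint : ∀ x ∈ Set.Icc a b, ∫ s in a..x, f₀ s * u s = F x / c₁ := fun x hx => by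
    rw [h.fst_eq x hx, mul_div_cancel_left₀ _ hc₁]
    refine intervalIntegral.integral_congr fun s hs => ?_
    rw [Set.uIcc_of_le hx.1] at hs
    exact hfu s ⟨hs.1, hs.2.trans hx.2⟩
  have hne : eLpNorm f₀ (ENNReal.ofReal p) (volume.restrict (Set.Icc a b)) ≠ 0 := by
    rw [Ne, eLpNorm_eq_zero_iff hmeas hp0]
    intro hae
    obtain ⟨x, hx, hFx, -⟩ := h.exists_ne
    have h0 : ∫ s in a..x, f₀ s * u s = 0 := by
      refine intervalIntegral.integral_zero_ae ?_
      rw [Filter.EventuallyEq, ae_restrict_iff' measurableSet_Icc] at hae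
      filter_upwards [hae] with s hs hsx
      rw [Set.uIoc_of_le hx.1] at hsx
      rw [hs ⟨hsx.1.le, hsx.2.trans hx.2⟩, Pi.zero_apply, zero_mul]
    rw [hint x hx, div_eq_zero_iff] at h0
    have hF0 := h0.resolve_right hc₁
    simp [hF0] at hFx
  set ℓ := (eLpNorm f₀ (ENNReal.ofReal p) (volume.restrict (Set.Icc a b))).toReal with hℓ
  have hℓ0 : 0 < ℓ := ENNReal.toReal_pos hne hmem.2.ne
  have hℓi : 0 < ℓ⁻¹ := inv_pos.2 hℓ0
  set f : ℝ → ℝ := fun x => ℓ⁻¹ * f₀ x with hf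
  have hg : ∀ x ∈ Set.Icc a b, hardyOp a u v f x = ℓ⁻¹ / c₁ * (v x * F x) := fun x hx => by
    have : ∫ s in a..x, f s * u s = ℓ⁻¹ * (F x / c₁) := by
      rw [← hint x hx, ← intervalIntegral.integral_const_mul]
      simp only [hf, mul_assoc]
    rw [hardyOp, this]
    ring
  have hD : signedPow q (ℓ⁻¹ / c₁) ≠ 0 := signedPow_ne_zero (div_ne_zero hℓi.ne' hc₁)
  -- Because `G b = 0`, the equation for `G` integrated from `x` to `b` is the dual operator applied
  -- to `φ_q(g)`, up to a constant and the factor `u`.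
  have hdual : ∀ x ∈ Set.Icc a b,
      ∫ y in x..b, v y * signedPow q (hardyOp a u v f y) =
        signedPow q (ℓ⁻¹ / c₁) / c₂ * G x := fun x hx => by
    have h1 := h.snd_sub hq hV hx ⟨hab.le, le_rfl⟩
    rw [h.snd_last, sub_zero] at h1
    rw [h1, div_mul_eq_mul_div, mul_left_comm, mul_div_cancel_left₀ _ hc₂,
      ← intervalIntegral.integral_const_mul]
    refine intervalIntegral.integral_congr fun y hy => ?_
    rw [Set.uIcc_of_le hx.2] at hy
    have hy' : y ∈ Set.Icc a b := ⟨hx.1.trans hy.1, hy.2⟩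
    rw [hg y hy', signedPow_mul, signedPow_mul, hVe y hy', ← signedPow_mul_self hq (hv_pos y hy')]
    ring
  -- The eigenvalue quotient corrects the different homogeneities: `φ_p` of the factor of `f` over
  -- the factor produced by the dual operator.
  refine ⟨(hardyOp a u v f, f, signedPow p ℓ⁻¹ / (signedPow q (ℓ⁻¹ / c₁) / c₂)),
    ⟨hmem.const_mul _, ?_, fun _ _ => rfl, fun x hx => ?_⟩, ?_⟩
  · have : f = ℓ⁻¹ • f₀ := rfl
    show eLpNorm f _ _ = 1
    rw [this, eLpNorm_const_smul, Real.enorm_of_nonneg hℓi.le, ENNReal.ofReal_inv_of_pos hℓ0, hℓ,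
      ENNReal.ofReal_toReal hmem.2.ne, ENNReal.inv_mul_cancel hne hmem.2.ne]
  · show signedPow p (f x) = _ * (u x * ∫ y in x..b, v y * signedPow q (hardyOp a u v f y))
    rw [hdual x hx]
    simp only [hf, hf₀]
    rw [signedPow_mul, signedPow_signedPow_conj hconj]
    generalize signedPow q (ℓ⁻¹ / c₁) = D at hD
    field_simp
  · show zeroCount a b (hardyOp a u v f) = n
    rw [← h.zeroCount_fst hP hq hU hV, zeroCount, zeroCount]
    congr 1
    ext x
    refine and_congr_right fun hx => ?_
    have hx' := Set.Ioo_subset_Icc_self hx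
    rw [hg x hx']
    simp [hℓ0.ne', hc₁, (hv_pos x hx').ne']

end HardySystem

theorem theorem2p2 (a b p q : ℝ) (hab : a < b) (hp : 1 < p) (hq : 1 < q) (u v : ℝ → ℝ)
    (hu_pos : ∀ x ∈ Set.Icc a b, 0 < u x) (hv_pos : ∀ x ∈ Set.Icc a b, 0 < v x)
    (hu : MemLp u (ENNReal.ofReal p.conjExponent) (volume.restrict (Set.Icc a b)))
    (hv : MemLp v (ENNReal.ofReal q) (volume.restrict (Set.Icc a b))) (n : ℕ) :
    (HardySystem.SPn a b p q u v n).Nonempty :=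
  HardySystem.exists_mem_SPn hab hp hq hu_pos hv_pos hu hv n
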